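/- Let $I=[0,\alpha)$ with $\alpha=1$ or $\alpha=\infty$, equipped with Lebesgue measure $\mu$, and let $L^0$ be the space of (classes of) measurable functions on $I$. For $x\in L^0$ put $d_x(\lambda)=\mu\{s\in I:|x(s)|>\lambda\}$ $(\lambda\ge 0)$, $x^*(t)=\inf\{\lambda>0:d_x(\lambda)\le t\}$ $(t\ge 0)$ and $x^{**}(t)=\frac1t\int_0^t x^*(s)\,ds$ $(t>0)$; if $\alpha=\infty$, put $x^*(\infty)=\lim_{t\to\infty}x^*(t)$. Write $x\prec y$ if $x^{**}(t)\le y^{**}(t)$ for all $t>0$. A Banach function space on $I$ is a Banach space $(E,\|\cdot\|_E)$ that is a linear subspace of $L^0$, contains a function which is strictly positive a.e., and is such that $x\in L^0$, $y\in E$, $|x|\le|y|$ a.e. imply $x\in E$ and $\|x\|_E\le\|y\|_E$. It is symmetric if $x\in L^0$, $y\in E$, $d_x=d_y$ imply $x\in E$ and $\|x\|_E=\|y\|_E$; its fundamental function is then $\phi(t)=\|\chi_{(0,t)}\|_E$. It has the Fatou property if, whenever $0\le x_n\in E$, $\sup_n\|x_n\|_E<\infty$ and $x_n\uparrow x\in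 L^0$ a.e., then $x\in E$ and $\|x_n\|_E\uparrow\|x\|_E$. A point $x\in E$ is a point of order continuity if $\|x_n\|_E\to 0$ for every sequence $(x_n)$ in $E$ with $0\le x_n\le|x|$ and $x_n\to 0$ a.e. It is a point of $K$-order continuity if $\|x_n\|_E\to 0$ for every sequence $(x_n)$ in $E$ with $x_n\prec x$ and $x_n^*\to 0$ a.e. **Theorem.** Let $E$ be a symmetric space (that is, a symmetric Banach function space) on $I$ with the Fatou property and with fundamental function $\phi$, and let $x\in E$. Then the following conditions are equivalent. (i) $x$ is a point of order continuity and, in case $\alpha=\infty$, $\phi(s)x^{**}(s)\to 0$ as $s\to\infty$. (ii) $x$ is a point of $K$-order continuity and, in case $\alpha=\infty$, $x^*(\infty)=0$. -/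

import Mathlib

open MeasureTheory Filter Topology
open scoped ENNReal NNReal

noncomputable section

namespace SymmSpace

/-- The interval `I = [0, α)`, as a set of reals, for `α ∈ [0, ∞]`. -/
def I (α : ℝ≥0∞) : Set ℝ := {t | 0 ≤ t ∧ ENNReal.ofReal t < α}

/-- Lebesgue measure on `I = [0, α)`. -/
def leb (α : ℝ≥0∞) : Measure ℝ := volume.restrict (I α)

/-- The space `L⁰` of classes, modulo equality a.e. on `I`, of measurable functions on `I`. -/
abbrev L0 (α : ℝ≥0∞) : Type := ℝ →ₘ[leb α] ℝ

/-- The distribution function `d_x(l) = μ {s ∈ I : |x(s)| > l}`. -/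
def distr {α : ℝ≥0∞} (x : L0 α) (l : ℝ≥0) : ℝ≥0∞ := leb α {s | (l : ℝ) < |x s|}

/-- The decreasing rearrangement `x*(t) = inf {l > 0 : d_x(l) ≤ t}`, for `t ≥ 0`; the infimum of the
empty set is `∞`. -/
def rearr {α : ℝ≥0∞} (x : L0 α) (t : ℝ) : ℝ≥0∞ :=
  ⨅ (l : ℝ≥0) (_ : 0 < l) (_ : distr x l ≤ ENNReal.ofReal t), (l : ℝ≥0∞)

/-- The maximal function `x**(t) = (1/t) ∫₀ᵗ x*(s) ds`, for `t > 0`. -/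
def maxFun {α : ℝ≥0∞} (x : L0 α) (t : ℝ) : ℝ≥0∞ :=
  (ENNReal.ofReal t)⁻¹ * ∫⁻ s in Set.Ioo 0 t, rearr x s

/-- The Hardy-Littlewood-Pólya relation `x ≺ y`. -/
def HLP {α : ℝ≥0∞} (x y : L0 α) : Prop := ∀ t : ℝ, 0 < t → maxFun x t ≤ maxFun y t

/-- Equimeasurable functions. -/
def Equimeasurable {α : ℝ≥0∞} (x y : L0 α) : Prop := ∀ l : ℝ≥0, distr x l = distr y l

/-- A Banach function space (Köthe space) on `I = [0, α)`. That it is a sublattice of `L⁰` and that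
its norm is a lattice norm is part of the field `ideal`. -/
structure BanachFunctionSpace (α : ℝ≥0∞) where
  /-- the underlying linear subspace of `L⁰` -/
  carrier : Submodule ℝ (L0 α)
  /-- the norm -/
  norm : Seminorm ℝ carrier
  eq_zero_of_norm : ∀ x : carrier, norm x = 0 → x = 0
  complete : ∀ u : ℕ → carrier,
    (∀ ε : ℝ, 0 < ε → ∃ N : ℕ, ∀ m n : ℕ, N ≤ m → N ≤ n → norm (u m - u n) < ε) →
    ∃ x : carrier, Tendsto (fun n => norm (u n - x)) atTop (𝓝 0)
  ideal : ∀ (x : L0 α) (y : carrier), |x| ≤ |(y : L0 α)| →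
    ∃ hx : x ∈ carrier, norm ⟨x, hx⟩ ≤ norm y
  exists_pos : ∃ y : carrier, ∀ᵐ t ∂(leb α), 0 < (y : L0 α) t

namespace BanachFunctionSpace

variable {α : ℝ≥0∞}

/-- Symmetric (rearrangement invariant) spaces. -/
def IsSymmetric (E : BanachFunctionSpace α) : Prop :=
  ∀ (x : L0 α) (y : E.carrier), Equimeasurable x (y : L0 α) →
    ∃ hx : x ∈ E.carrier, E.norm ⟨x, hx⟩ = E.norm y

/-- The Fatou property. -/
def Fatou (E : BanachFunctionSpace α) : Prop :=
  ∀ (u : ℕ → E.carrier) (x : L0 α), (∀ n, (0 : L0 α) ≤ u n) →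
    (∀ n, (u n : L0 α) ≤ u (n + 1)) → BddAbove (Set.range fun n => E.norm (u n)) →
    (∀ᵐ t ∂(leb α), Tendsto (fun n => (u n : L0 α) t) atTop (𝓝 (x t))) →
    ∃ hx : x ∈ E.carrier, Tendsto (fun n => E.norm (u n)) atTop (𝓝 (E.norm ⟨x, hx⟩))

/-- `x` is a point of order continuity of `E`. -/
def IsOCPoint (E : BanachFunctionSpace α) (x : E.carrier) : Prop :=
  ∀ u : ℕ → E.carrier, (∀ n, (0 : L0 α) ≤ u n) → (∀ n, (u n : L0 α) ≤ |(x : L0 α)|) →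
    (∀ᵐ t ∂(leb α), Tendsto (fun n => (u n : L0 α) t) atTop (𝓝 0)) →
    Tendsto (fun n => E.norm (u n)) atTop (𝓝 0)

/-- `x` is a point of `K`-order continuity of `E`. -/
def IsKOCPoint (E : BanachFunctionSpace α) (x : E.carrier) : Prop :=
  ∀ u : ℕ → E.carrier, (∀ n, HLP (u n : L0 α) (x : L0 α)) →
    (∀ᵐ t ∂(leb α), Tendsto (fun n => rearr (u n : L0 α) t) atTop (𝓝 0)) →
    Tendsto (fun n => E.norm (u n)) atTop (𝓝 0)

end BanachFunctionSpace

/-- The class of the characteristic function of a measurable set. -/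
def ind (α : ℝ≥0∞) (A : Set ℝ) (hA : MeasurableSet A) : L0 α :=
  AEEqFun.mk (A.indicator fun _ => (1 : ℝ))
    (measurable_const.indicator hA).aestronglyMeasurable

/-- The class of the characteristic function of `(0, t)`. -/
def chi (α : ℝ≥0∞) (t : ℝ) : L0 α := ind α (Set.Ioo 0 t) measurableSet_Ioo

theorem measurableSet_I (α : ℝ≥0∞) : MeasurableSet (I α) :=
  measurableSet_Ici.inter (measurableSet_lt ENNReal.measurable_ofReal measurable_const)

theorem leb_univ (α : ℝ≥0∞) : leb α Set.univ = α := by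
  rw [leb, Measure.restrict_apply_univ]
  rcases eq_or_ne α ∞ with rfl | h
  · have : I ∞ = Set.Ici 0 := by ext; simp [I]
    rw [this, Real.volume_Ici]
  · have : I α = Set.Ico 0 α.toReal := by
      ext t
      simp only [I, Set.mem_ofPred_eq, Set.mem_Ico]
      refine and_congr_right fun ht => ?_
      rw [ENNReal.ofReal_lt_iff_lt_toReal ht h]
    rw [this, Real.volume_Ico, sub_zero, ENNReal.ofReal_toReal h]

theorem leb_Ioo (α : ℝ≥0∞) {r : ℝ} (h : ENNReal.ofReal r ≤ α) :
    leb α (Set.Ioo 0 r) = ENNReal.ofReal r := by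
  rw [leb, Measure.restrict_apply measurableSet_Ioo]
  have : Set.Ioo 0 r ∩ I α = Set.Ioo 0 r := by
    refine Set.inter_eq_left.mpr fun t ht => ⟨ht.1.le, lt_of_lt_of_le ?_ h⟩
    exact (ENNReal.ofReal_lt_ofReal_iff (ht.1.trans ht.2)).mpr ht.2
  rw [this, Real.volume_Ioo, sub_zero]

theorem coeFn_ind (α : ℝ≥0∞) (A : Set ℝ) (hA : MeasurableSet A) :
    (ind α A hA : ℝ → ℝ) =ᵐ[leb α] A.indicator fun _ => (1 : ℝ) :=
  AEEqFun.coeFn_mk _ _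

theorem distr_ind (α : ℝ≥0∞) (A : Set ℝ) (hA : MeasurableSet A) (l : ℝ≥0) :
    distr (ind α A hA) l = if l < 1 then leb α A else 0 := by
  have h : leb α {s | (l : ℝ) < |ind α A hA s|}
      = leb α {s | (l : ℝ) < |A.indicator (fun _ => (1 : ℝ)) s|} := by
    apply measure_congr
    filter_upwards [coeFn_ind α A hA] with s hs
    apply propext
    change (l : ℝ) < |ind α A hA s| ↔ (l : ℝ) < |A.indicator (fun _ => (1 : ℝ)) s|
    rw [hs]
  unfold distr
  rw [h]
  split_ifs with hl
  · congr 1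
    ext s
    by_cases hs : s ∈ A
    · simpa [hs] using hl
    · simp [hs]
  · have : {s | (l : ℝ) < |A.indicator (fun _ => (1 : ℝ)) s|} = ∅ := by
      ext s
      by_cases hs : s ∈ A
      · simpa [hs] using hl
      · simp [hs]
    rw [this, measure_empty]

theorem equimeasurable_ind (α : ℝ≥0∞) {A B : Set ℝ} (hA : MeasurableSet A) (hB : MeasurableSet B)
    (h : leb α A = leb α B) : Equimeasurable (ind α A hA) (ind α B hB) := by
  intro l
  rw [distr_ind, distr_ind, h]

namespace BanachFunctionSpace

variable {α : ℝ≥0∞}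

theorem ind_mem_mono (E : BanachFunctionSpace α) {A B : Set ℝ} (hA : MeasurableSet A)
    (hB : MeasurableSet B) (h : A ⊆ B) (hm : ind α B hB ∈ E.carrier) :
    ind α A hA ∈ E.carrier := by
  refine (E.ideal _ ⟨_, hm⟩ ?_).1
  rw [← AEEqFun.coeFn_le]
  filter_upwards [coeFn_ind α A hA, coeFn_ind α B hB, AEEqFun.coeFn_abs (ind α A hA),
    AEEqFun.coeFn_abs (ind α B hB)] with s h1 h2 h3 h4
  rw [h3, h4, h1, h2]
  by_cases hs : s ∈ A
  · simp [hs, h hs]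
  · simp [hs]

theorem ind_mem_union (E : BanachFunctionSpace α) {A B : Set ℝ} (hA : MeasurableSet A)
    (hB : MeasurableSet B) (h1 : ind α A hA ∈ E.carrier) (h2 : ind α B hB ∈ E.carrier) :
    ind α (A ∪ B) (hA.union hB) ∈ E.carrier := by
  refine (E.ideal _ ⟨_, E.carrier.add_mem h1 h2⟩ ?_).1
  rw [← AEEqFun.coeFn_le]
  filter_upwards [coeFn_ind α A hA, coeFn_ind α B hB, coeFn_ind α (A ∪ B) (hA.union hB),
    AEEqFun.coeFn_abs (ind α (A ∪ B) (hA.union hB)),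
    AEEqFun.coeFn_abs (ind α A hA + ind α B hB),
    AEEqFun.coeFn_add (ind α A hA) (ind α B hB)] with s h1 h2 h3 h4 h5 h6
  rw [h4, h5, h6, Pi.add_apply, h1, h2, h3]
  by_cases hs : s ∈ A <;> by_cases hs' : s ∈ B <;> simp [hs, hs']
  norm_num

theorem ind_mem_of_leb_le (E : BanachFunctionSpace α) (hE : E.IsSymmetric) {d : ℝ}
    (hdα : ENNReal.ofReal d ≤ α)
    (hm : ind α (Set.Ioo 0 d) measurableSet_Ioo ∈ E.carrier) {C : Set ℝ} (hC : MeasurableSet C)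
    (h : leb α C ≤ ENNReal.ofReal d) : ind α C hC ∈ E.carrier := by
  have hfin : leb α C ≠ ∞ := ne_top_of_le_ne_top ENNReal.ofReal_ne_top h
  have h1 : ind α (Set.Ioo 0 (leb α C).toReal) measurableSet_Ioo ∈ E.carrier := by
    rcases le_or_gt d 0 with hd | hd
    · rw [ENNReal.ofReal_of_nonpos hd] at h
      have h0 : leb α C = 0 := le_antisymm h bot_le
      refine E.ind_mem_mono _ measurableSet_Ioo ?_ hm
      simp [h0]
    · refine E.ind_mem_mono _ measurableSet_Ioo ?_ hm
      exact Set.Ioo_subset_Ioo_right (ENNReal.toReal_le_of_le_ofReal hd.le h)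
  refine (hE _ ⟨_, h1⟩ (equimeasurable_ind α hC measurableSet_Ioo ?_)).1
  rw [leb_Ioo, ENNReal.ofReal_toReal hfin]
  rw [ENNReal.ofReal_toReal hfin]
  exact h.trans hdα

theorem exists_ind_mem (E : BanachFunctionSpace α) (hE : E.IsSymmetric) (hα : 0 < α) :
    ∃ d : ℝ, 0 < d ∧ ENNReal.ofReal d ≤ α ∧
      ind α (Set.Ioo 0 d) measurableSet_Ioo ∈ E.carrier := by
  obtain ⟨y, hy⟩ := E.exists_pos
  have hmeas : Measurable ((y : L0 α) : ℝ → ℝ) := (AEEqFun.stronglyMeasurable _).measurable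
  have hA : ∃ k : ℕ, 0 < leb α {s | 1 / ((k : ℝ) + 1) < (y : L0 α) s} := by
    by_contra! hcon
    have h0 : ∀ᵐ s ∂(leb α), ∀ k : ℕ, ¬ (1 / ((k : ℝ) + 1) < (y : L0 α) s) := by
      rw [ae_all_iff]
      intro k
      rw [ae_iff]
      simpa using hcon k
    have h1 : ∀ᵐ s ∂(leb α), False := by
      filter_upwards [h0, hy] with s hs hs'
      obtain ⟨k, hk⟩ := exists_nat_one_div_lt hs'
      exact hs k hk
    have h2 : leb α Set.univ = 0 := by simpa [ae_iff] using h1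
    rw [leb_univ] at h2
    exact hα.ne' h2
  obtain ⟨k, hk⟩ := hA
  set A : Set ℝ := {s | 1 / ((k : ℝ) + 1) < (y : L0 α) s} with hAdef
  have hAm : MeasurableSet A := measurableSet_lt measurable_const hmeas
  have hkpos : (0 : ℝ) < (k : ℝ) + 1 := by positivity
  have hAE : ind α A hAm ∈ E.carrier := by
    refine (E.ideal _ (((k : ℝ) + 1) • y) ?_).1
    rw [← AEEqFun.coeFn_le]
    filter_upwards [coeFn_ind α A hAm, AEEqFun.coeFn_abs (ind α A hAm),
      AEEqFun.coeFn_abs ((((k : ℝ) + 1) • y : E.carrier) : L0 α),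
      AEEqFun.coeFn_smul ((k : ℝ) + 1) (y : L0 α)] with s h1 h2 h3 h4
    rw [h2, h3, h1, Submodule.coe_smul, h4, Pi.smul_apply]
    by_cases hs : s ∈ A
    · have h5 : 1 / ((k : ℝ) + 1) < (y : L0 α) s := hs
      rw [div_lt_iff₀ hkpos] at h5
      simp only [hs, Set.indicator_of_mem, smul_eq_mul, abs_one]
      refine le_trans ?_ (le_abs_self _)
      linarith
    · rw [Set.indicator_of_notMem hs, abs_zero]
      exact abs_nonneg _
  have : SigmaFinite (leb α) := by unfold leb; infer_instance
  obtain ⟨B, hB, hBA, hB0, hBt⟩ := Measure.exists_subset_measure_lt_top hAm hk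
  have hle : ENNReal.ofReal (leb α B).toReal ≤ α := by
    rw [ENNReal.ofReal_toReal hBt.ne]
    exact (measure_mono (Set.subset_univ _)).trans (leb_univ α).le
  refine ⟨(leb α B).toReal, ENNReal.toReal_pos hB0.ne' hBt.ne, hle, ?_⟩
  refine (hE _ ⟨_, E.ind_mem_mono hB hAm hBA hAE⟩
    (equimeasurable_ind α measurableSet_Ioo hB ?_)).1
  rw [leb_Ioo α hle, ENNReal.ofReal_toReal hBt.ne]

/-- A symmetric space contains the characteristic functions of bounded intervals. -/
theorem chi_mem (E : BanachFunctionSpace α) (hE : E.IsSymmetric) (t : ℝ) :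
    chi α t ∈ E.carrier := by
  rcases eq_or_ne α 0 with rfl | hα
  · have h0 : chi 0 t = 0 := by
      apply AEEqFun.ext
      have h2 : leb 0 = 0 := by
        rw [← Measure.measure_univ_eq_zero, leb_univ]
      have h3 : ae (leb 0) = ⊥ := ae_eq_bot.mpr h2
      unfold Filter.EventuallyEq
      rw [h3]
      exact eventually_bot
    rw [h0]
    exact E.carrier.zero_mem
  obtain ⟨d, hd, hdα, hm⟩ := E.exists_ind_mem hE (pos_iff_ne_zero.mpr hα)
  have key : ∀ n : ℕ, ind α (Set.Ioo 0 (n * d)) measurableSet_Ioo ∈ E.carrier := by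
    intro n
    induction n with
    | zero => exact E.ind_mem_mono _ measurableSet_Ioo (by simp) hm
    | succ n ih =>
      have hp : ind α (Set.Ico (n * d) ((n + 1) * d)) measurableSet_Ico ∈ E.carrier := by
        refine E.ind_mem_of_leb_le hE hdα hm _ ?_
        refine (Measure.restrict_apply_le _ _).trans ?_
        rw [Real.volume_Ico]
        apply ENNReal.ofReal_le_ofReal
        linarith
      refine E.ind_mem_mono _ (measurableSet_Ioo.union measurableSet_Ico) ?_
        (E.ind_mem_union measurableSet_Ioo measurableSet_Ico ih hp)
      intro s hs
      rcases lt_or_ge s (n * d) with h | h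
      · exact Or.inl ⟨hs.1, h⟩
      · exact Or.inr ⟨h, by simpa using hs.2⟩
  obtain ⟨n, hn⟩ := exists_nat_gt (t / d)
  refine E.ind_mem_mono measurableSet_Ioo measurableSet_Ioo ?_ (key n)
  exact Set.Ioo_subset_Ioo_right ((div_lt_iff₀ hd).mp hn).le

/-- The fundamental function `φ(t) = ‖χ_(0,t)‖` of a symmetric space. -/
def fundamental (E : BanachFunctionSpace α) (hE : E.IsSymmetric) (t : ℝ) : ℝ :=
  E.norm ⟨chi α t, E.chi_mem hE t⟩

end BanachFunctionSpace

end SymmSpace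
end

/-! For (i) ⇒ (ii), order continuity makes the head `x* χ_(0,δ)` and the tail `x* χ_[N,∞)` of the
rearrangement small in norm: the parts of `|x|` above a high level and up to a low level tend to
zero, each is equimeasurable with the same part of `x*`, and `φ(0+) = 0` unless `x = 0`. If `u ≺ x`
and `u* ≤ e` beyond `δ`, then `u*` is submajorized by the decreasing function equal to `(c + e) + x*
χ_(0,δ)` on `(0,N)` and to `x*` beyond `N` (taking `δ ≤ N` for this description), where `c` bounds
`x**(N)` (`rho_le_of_HLP`). Hence `‖u‖` is at most head + `(c + e) φ(N)` + tail. The hypothesis on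
`φ x**` makes `c φ(N)` small for large `N`; then `e` is chosen small against `φ(N)`, and `u_n* → 0`
yields `u_n* ≤ e` beyond `δ` for large `n`.

This needs the norm to be monotone under submajorization (`rho_le_of_lintegral_le`), which is where
the Fatou property enters. It comes from a finite-dimensional inequality
(`seminorm_le_of_partial_sums`, by Hahn-Banach, rearrangement and Abel summation) applied to dyadic
step functions, all of whose cells have equal measure.

For (ii) ⇒ (i), order continuity follows because `|u| ≤ |x|` implies `u ≺ x`, and because dominated
a.e. convergence gives convergence of rearrangements when `x` has finite distribution function at
positive levels. The limit of `φ x**` comes from the test functions `x**(s) χ_(0,s) ≺ x`, whose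
norms are exactly `φ(s) x**(s)`. Finiteness of `x**` is itself a consequence of K-order continuity.
-/

namespace SymmSpace

/-! ### Submajorization and symmetric seminorms on `ℝⁿ`. -/

/-- Abel summation inequality. -/
theorem sum_range_mul_nonneg {d e : ℕ → ℝ} (hd : Antitone d) (hd0 : ∀ i, 0 ≤ d i) (n : ℕ)
    (he : ∀ j ≤ n, 0 ≤ ∑ i ∈ Finset.range j, e i) :
    0 ≤ ∑ i ∈ Finset.range n, d i * e i := by
  have h := Finset.sum_range_by_parts d e n
  simp only [smul_eq_mul] at h
  rw [h, sub_nonneg]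
  refine (Finset.sum_nonpos fun i hi => ?_).trans (mul_nonneg (hd0 _) (he n le_rfl))
  refine mul_nonpos_of_nonpos_of_nonneg (sub_nonpos.2 (hd (Nat.le_succ i))) (he _ ?_)
  have := Finset.mem_range.1 hi
  omega

/-- If `a` is decreasing and nonnegative, then its partial sums being dominated by those of `b`
implies `N a ≤ N b` for every symmetric seminorm `N`. -/
theorem seminorm_le_of_partial_sums {n : ℕ} (N : Seminorm ℝ (Fin n → ℝ))
    (hN : ∀ (v w : Fin n → ℝ) (σ : Equiv.Perm (Fin n)), (∀ i, |v (σ i)| = |w i|) → N v = N w)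
    (a b : ℕ → ℝ) (ha : Antitone a) (ha0 : ∀ i, 0 ≤ a i)
    (hab : ∀ j ≤ n, ∑ i ∈ Finset.range j, a i ≤ ∑ i ∈ Finset.range j, b i) :
    N (fun i => a i) ≤ N (fun i => b i) := by
  set A : Fin n → ℝ := fun i => a i with hA
  by_cases hA0 : A = 0
  · rw [hA0, map_zero]
    exact apply_nonneg N _
  -- Hahn-Banach: a linear functional below `N` that attains `N A` at `A`.
  obtain ⟨g, hg, hgN⟩ := exists_extension_of_le_sublinear
    (LinearPMap.mkSpanSingleton (σ := RingHom.id ℝ) A (N A) hA0) N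
    (fun c hc x => by rw [map_smul_eq_mul, Real.norm_of_nonneg hc.le])
    (fun x y => map_add_le_add N x y) (by
      rintro ⟨x, hx⟩
      obtain ⟨c, rfl⟩ := Submodule.mem_span_singleton.1 hx
      rw [LinearPMap.mkSpanSingleton'_apply]
      simp only [RingHom.id_apply, smul_eq_mul, map_smul_eq_mul, Real.norm_eq_abs]
      exact mul_le_mul_of_nonneg_right (le_abs_self c) (apply_nonneg N _))
  have hgA : g A = N A := by
    have := hg ⟨A, Submodule.mem_span_singleton_self _⟩
    rw [LinearPMap.mkSpanSingleton_apply] at this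
    exact this
  set c : Fin n → ℝ := fun i => g (fun j => if i = j then 1 else 0) with hc
  have hgc : ∀ v, g v = ∑ i, v i * c i := fun v => by
    rw [LinearMap.pi_apply_eq_sum_univ]
    rfl
  -- Sorting `|c|` decreasingly can only increase the pairing with the decreasing vector `A`, and
  -- makes Abel summation applicable.
  set σ : Equiv.Perm (Fin n) := Tuple.sort (fun i => -|c i|) with hσ
  have hmono : Antitone (fun i => |c (σ i)|) := fun i j hij => by
    have := Tuple.monotone_sort (fun i => -|c i|) hij
    simpa using this
  have h1 : ∑ i, A i * c i ≤ ∑ i, A i * |c (σ i)| := by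
    have hmv : Monovary A (fun i => |c (σ i)|) :=
      (show Antitone A from fun i j hij => ha hij).monovary hmono
    have h2 := hmv.sum_mul_comp_perm_le_sum_mul (σ := σ⁻¹)
    refine le_trans (Finset.sum_le_sum fun i _ => ?_) h2
    have : σ (σ⁻¹ i) = i := by simp
    rw [this]
    exact mul_le_mul_of_nonneg_left (le_abs_self _) (ha0 _)
  set d : ℕ → ℝ := fun i => if h : i < n then |c (σ ⟨i, h⟩)| else 0 with hd
  have hdanti : Antitone d := by
    intro i j hij
    simp only [hd]
    split_ifs with h1 h2
    · exact hmono (by simpa using hij)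
    · omega
    · exact abs_nonneg _
    · exact le_rfl
  have hd0 : ∀ i, 0 ≤ d i := by
    intro i
    simp only [hd]
    split_ifs
    · exact abs_nonneg _
    · exact le_rfl
  have hdi : ∀ i : Fin n, d i = |c (σ i)| := fun i => by simp [hd]
  have h3 : ∑ i : Fin n, A i * |c (σ i)| ≤ ∑ i : Fin n, b i * |c (σ i)| := by
    have h4 := sum_range_mul_nonneg (e := fun i => b i - a i) hdanti hd0 n (fun j hj => by
      rw [Finset.sum_sub_distrib, sub_nonneg]
      exact hab j hj)
    rw [← Fin.sum_univ_eq_sum_range (fun i => d i * (b i - a i)) n] at h4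
    rw [← sub_nonneg, ← Finset.sum_sub_distrib]
    refine h4.trans_eq (Finset.sum_congr rfl fun i _ => ?_)
    rw [hdi, hA]
    ring
  -- `v` is `b` permuted and signed so that `g v` equals the sorted pairing; symmetry of `N` gives
  -- `N v = N b`.
  set v : Fin n → ℝ := fun j => b (σ⁻¹ j : Fin n) * (if 0 ≤ c j then 1 else -1) with hv
  have h5 : g v = ∑ i : Fin n, b i * |c (σ i)| := by
    rw [hgc, ← Equiv.sum_comp σ]
    refine Finset.sum_congr rfl fun i _ => ?_
    have : σ⁻¹ (σ i) = i := by simp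
    rw [hv]
    simp only [this]
    split_ifs with h
    · rw [abs_of_nonneg h, mul_one]
    · rw [abs_of_neg (not_le.1 h)]; ring
  calc N A = ∑ i, A i * c i := by rw [← hgA, hgc]
    _ ≤ g v := by rw [h5]; exact h1.trans h3
    _ ≤ N v := hgN v
    _ = N (fun i => b i) := by
      refine hN _ _ σ fun i => ?_
      have : σ⁻¹ (σ i) = i := by simp
      rw [hv]
      simp only [this, abs_mul]
      split_ifs <;> simp

/-- On a block where `a` is constant and `b` is decreasing, the comparison of partial sums at the
two ends gives the comparison inside. -/
theorem partial_sums_le_of_block {a b : ℕ → ℝ} {p q : ℕ} {c : ℝ} (hb : Antitone b)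
    (hac : ∀ i, p ≤ i → i < q → a i = c)
    (hp : ∑ i ∈ Finset.range p, a i ≤ ∑ i ∈ Finset.range p, b i)
    (hq : ∑ i ∈ Finset.range q, a i ≤ ∑ i ∈ Finset.range q, b i) {j : ℕ} (hpj : p ≤ j)
    (hjq : j ≤ q) : ∑ i ∈ Finset.range j, a i ≤ ∑ i ∈ Finset.range j, b i := by
  by_cases h : ∀ i, p ≤ i → i < j → c ≤ b i
  · rw [← Finset.sum_range_add_sum_Ico _ hpj, ← Finset.sum_range_add_sum_Ico b hpj]
    refine add_le_add hp (Finset.sum_le_sum fun i hi => ?_)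
    obtain ⟨h1, h2⟩ := Finset.mem_Ico.1 hi
    rw [hac i h1 (h2.trans_le hjq)]
    exact h i h1 h2
  -- Once `b` falls below `c` before `j`, it stays below on `[j, q)`; removing that tail from the
  -- comparison at `q` leaves the one at `j`.
  · push Not at h
    obtain ⟨i₀, h1, h2, h3⟩ := h
    rw [← Finset.sum_range_add_sum_Ico _ hjq, ← Finset.sum_range_add_sum_Ico b hjq] at hq
    have : ∑ i ∈ Finset.Ico j q, b i ≤ ∑ i ∈ Finset.Ico j q, a i := by
      refine Finset.sum_le_sum fun i hi => ?_
      obtain ⟨h4, h5⟩ := Finset.mem_Ico.1 hi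
      rw [hac i (hpj.trans h4) h5]
      exact (hb (h2.le.trans h4)).trans h3.le
    linarith

end SymmSpace

/-! ### Distribution functions and decreasing rearrangements. -/

namespace SymmSpace

variable {α : ℝ≥0∞}

theorem distr_le (x : L0 α) (l : ℝ≥0) : distr x l ≤ α :=
  (measure_mono (Set.subset_univ _)).trans (leb_univ α).le

theorem distr_antitone (x : L0 α) : Antitone (distr x) := fun _ _ h =>
  measure_mono fun _ hs => lt_of_le_of_lt (NNReal.coe_le_coe.2 h) hs

theorem distr_mono {x y : L0 α} (h : ∀ᵐ t ∂(leb α), |x t| ≤ |y t|) (l : ℝ≥0) :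
    distr x l ≤ distr y l := by
  refine measure_mono_ae ?_
  filter_upwards [h] with t ht hlt
  exact lt_of_lt_of_le hlt ht

theorem rearr_le_of_distr_le {x : L0 α} {l : ℝ≥0} {t : ℝ} (h : distr x l ≤ ENNReal.ofReal t) :
    rearr x t ≤ l := by
  by_contra! hlt
  obtain ⟨m, h1, h2⟩ := ENNReal.lt_iff_exists_nnreal_btwn.1 hlt
  have hlm : l < m := by exact_mod_cast h1
  have : rearr x t ≤ m := iInf_le_of_le m (iInf_le_of_le (hlm.trans_le' bot_le)
    (iInf_le _ ((distr_antitone x hlm.le).trans h)))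
  exact absurd this (not_le.2 h2)

/-- Right continuity of the distribution function, from continuity of measure along `{|x| > l +
1/(n+1)}`, makes the correspondence exact with strict inequalities. -/
theorem lt_rearr_iff (x : L0 α) (l : ℝ≥0) (t : ℝ) :
    (l : ℝ≥0∞) < rearr x t ↔ ENNReal.ofReal t < distr x l := by
  constructor
  · intro h
    by_contra! hle
    exact absurd (rearr_le_of_distr_le hle) (not_le.2 h)
  · intro h
    have hU : distr x l = ⨆ n : ℕ, distr x (l + 1 / ((n : ℝ≥0) + 1)) := by
      unfold distr
      rw [← Monotone.measure_iUnion]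
      · congr 1
        ext s
        simp only [Set.mem_ofPred_eq, Set.mem_iUnion]
        constructor
        · intro hs
          obtain ⟨n, hn⟩ := exists_nat_one_div_lt (sub_pos.2 hs)
          refine ⟨n, ?_⟩
          push_cast
          linarith
        · rintro ⟨n, hn⟩
          refine lt_of_le_of_lt ?_ hn
          exact_mod_cast le_self_add
      · intro m n hmn s hs
        change ((l + 1 / ((m : ℝ≥0) + 1) : ℝ≥0) : ℝ) < |x s| at hs
        refine lt_of_le_of_lt ?_ hs
        have : (m : ℝ≥0) ≤ n := by exact_mod_cast hmn
        have : l + 1 / ((n : ℝ≥0) + 1) ≤ l + 1 / ((m : ℝ≥0) + 1) := by gcongr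
        exact_mod_cast this
    rw [hU, lt_iSup_iff] at h
    obtain ⟨n, hn⟩ := h
    have h1 : ((l + 1 / ((n : ℝ≥0) + 1) : ℝ≥0) : ℝ≥0∞) ≤ rearr x t := by
      refine le_iInf fun m => le_iInf fun _ => le_iInf fun hm => ?_
      by_contra! hlt
      have hlt' : m < l + 1 / ((n : ℝ≥0) + 1) := by exact_mod_cast hlt
      exact absurd ((distr_antitone x hlt'.le).trans hm) (not_le.2 hn)
    refine lt_of_lt_of_le ?_ h1
    have : l < l + 1 / ((n : ℝ≥0) + 1) := lt_add_of_pos_right _ (by positivity)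
    exact_mod_cast this

theorem rearr_le_iff (x : L0 α) (l : ℝ≥0) (t : ℝ) :
    rearr x t ≤ l ↔ distr x l ≤ ENNReal.ofReal t := by
  rw [← not_lt, lt_rearr_iff, not_lt]

theorem rearr_antitone (x : L0 α) : Antitone (rearr x) := fun _ _ h =>
  iInf_mono fun _ => iInf_mono fun _ => iInf_mono' fun h' =>
    ⟨h'.trans (ENNReal.ofReal_le_ofReal h), le_rfl⟩

theorem rearr_le_rearr {x y : L0 α} (h : ∀ l, distr x l ≤ distr y l) (t : ℝ) :
    rearr x t ≤ rearr y t :=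
  iInf_mono fun l => iInf_mono fun _ => iInf_mono' fun h' => ⟨(h l).trans h', le_rfl⟩

theorem rearr_eq_zero (x : L0 α) {t : ℝ} (h : α ≤ ENNReal.ofReal t) : rearr x t = 0 := by
  have := rearr_le_of_distr_le (l := 0) ((distr_le x 0).trans h)
  simpa using this

/-- If the distribution function is finite somewhere, it tends to zero at infinity. -/
theorem exists_distr_le (x : L0 α) {l : ℝ≥0} (hl : distr x l ≠ ∞) {c : ℝ≥0∞} (hc : 0 < c) :
    ∃ m : ℝ≥0, distr x m ≤ c := by
  have hx : Measurable (x : ℝ → ℝ) := (AEEqFun.stronglyMeasurable x).measurable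
  have h := tendsto_measure_iInter_atTop (μ := leb α)
    (s := fun n : ℕ => {s | ((n : ℝ≥0) : ℝ) < |x s|})
    (fun n => (measurableSet_lt measurable_const hx.abs).nullMeasurableSet)
    (fun m n hmn s (hs : ((n : ℝ≥0) : ℝ) < |x s|) => lt_of_le_of_lt (by simpa using hmn) hs)
    ⟨⌈l⌉₊, ne_top_of_le_ne_top hl (distr_antitone x (Nat.le_ceil l))⟩
  have h0 : (⋂ n : ℕ, {s | ((n : ℝ≥0) : ℝ) < |x s|}) = ∅ := by
    ext s
    simp only [Set.mem_iInter, Set.mem_ofPred_eq, Set.mem_empty_iff_false, iff_false, not_forall,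
      not_lt]
    obtain ⟨n, hn⟩ := exists_nat_ge |x s|
    exact ⟨n, by simpa using hn⟩
  rw [h0, measure_empty] at h
  obtain ⟨n, hn⟩ := (h.eventually (ge_mem_nhds hc)).exists
  exact ⟨n, hn⟩

theorem rearr_ne_top {x : L0 α} {l : ℝ≥0} (hl : distr x l ≠ ∞) {t : ℝ} (ht : 0 < t) :
    rearr x t ≠ ∞ := by
  obtain ⟨m, hm⟩ := exists_distr_le x hl (ENNReal.ofReal_pos.2 ht)
  exact ne_top_of_le_ne_top ENNReal.coe_ne_top (rearr_le_of_distr_le hm)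

theorem measurable_rearr (x : L0 α) : Measurable (rearr x) := (rearr_antitone x).measurable

/-- The class of a measurable function. -/
noncomputable def cls (α : ℝ≥0∞) (f : ℝ → ℝ) (hf : Measurable f) : L0 α :=
  AEEqFun.mk f hf.aestronglyMeasurable

theorem coeFn_cls (α : ℝ≥0∞) {f : ℝ → ℝ} (hf : Measurable f) : cls α f hf =ᵐ[leb α] f :=
  AEEqFun.coeFn_mk _ _

theorem distr_cls {f : ℝ → ℝ} (hf : Measurable f) (l : ℝ≥0) :
    distr (cls α f hf) l = leb α {s | (l : ℝ) < |f s|} := by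
  refine measure_congr ?_
  filter_upwards [coeFn_cls α hf] with s hs
  apply propext
  change (l : ℝ) < |cls α f hf s| ↔ (l : ℝ) < |f s|
  rw [hs]

theorem ae_leb_pos (α : ℝ≥0∞) : ∀ᵐ t ∂(leb α), 0 < t ∧ ENNReal.ofReal t < α := by
  have h1 : ∀ᵐ t ∂(leb α), t ∈ I α := ae_restrict_mem (measurableSet_I α)
  have h2 : ∀ᵐ t ∂(leb α), t ≠ 0 := by
    refine ae_restrict_of_ae ?_
    simp [ae_iff]
  filter_upwards [h1, h2] with t ht ht0
  exact ⟨lt_of_le_of_ne ht.1 ht0.symm, ht.2⟩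

theorem leb_I {a : ℝ≥0∞} (h : a ≤ α) : leb α {t | ENNReal.ofReal t < a} = a := by
  refine Eq.trans ?_ (leb_univ a)
  rw [leb, leb, Measure.restrict_apply, Measure.restrict_apply_univ]
  · congr 1
    ext t
    simp only [I, Set.mem_inter_iff, Set.mem_ofPred_eq]
    exact ⟨fun ⟨h1, h2, _⟩ => ⟨h2, h1⟩, fun ⟨h1, h2⟩ => ⟨h2, h1, h2.trans_le h⟩⟩
  · exact measurableSet_lt ENNReal.measurable_ofReal measurable_const

/-- The decreasing rearrangement as a class of functions on `I`. -/
noncomputable def star (x : L0 α) : L0 α := cls α (fun t => (rearr x t).toReal) (measurable_rearr x).ennreal_toReal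

theorem coeFn_star (x : L0 α) : star x =ᵐ[leb α] fun t => (rearr x t).toReal := coeFn_cls _ _

/-- Up to a null set, `{x* > l}` is `[0, d_x(l))`. Finiteness of `d_x` at one level makes `x*`
finite on `(0,∞)`, so `toReal` loses nothing. -/
theorem equimeasurable_star {x : L0 α} {l₀ : ℝ≥0} (h : distr x l₀ ≠ ∞) :
    Equimeasurable (star x) x := by
  intro l
  rw [star, distr_cls, ← leb_I (distr_le x l)]
  refine measure_congr ?_
  filter_upwards [ae_leb_pos α] with t ht
  apply propext
  change (l : ℝ) < |(rearr x t).toReal| ↔ ENNReal.ofReal t < distr x l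
  rw [← lt_rearr_iff, abs_of_nonneg ENNReal.toReal_nonneg]
  have hfin := rearr_ne_top h ht.1
  rw [← ENNReal.toReal_lt_toReal ENNReal.coe_ne_top hfin]
  rfl

theorem Equimeasurable.symm' {x y : L0 α} (h : Equimeasurable x y) : Equimeasurable y x :=
  fun l => (h l).symm

/-- The part of `|x|` above the level `M`. -/
noncomputable def hi (M : ℝ≥0) (x : L0 α) : L0 α :=
  cls α ({t | (M : ℝ) < |x t|}.indicator fun t => |x t|)
    ((AEEqFun.stronglyMeasurable x).measurable.abs.indicator
      (measurableSet_lt measurable_const (AEEqFun.stronglyMeasurable x).measurable.abs))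

/-- The part of `|x|` up to the level `m`. -/
noncomputable def lo (m : ℝ≥0) (x : L0 α) : L0 α :=
  cls α ({t | |x t| ≤ (m : ℝ)}.indicator fun t => |x t|)
    ((AEEqFun.stronglyMeasurable x).measurable.abs.indicator
      (measurableSet_le (AEEqFun.stronglyMeasurable x).measurable.abs measurable_const))

theorem distr_hi (M : ℝ≥0) (x : L0 α) (l : ℝ≥0) : distr (hi M x) l = distr x (max l M) := by
  rw [hi, distr_cls, distr]
  congr 1
  ext t
  simp only [Set.mem_ofPred_eq, NNReal.coe_max, max_lt_iff, Set.indicator_apply]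
  split_ifs with h
  · simp [h]
  · simp [h]

/-- Finiteness at level `m` allows the measure of `{|x| > max l m}` to be subtracted. -/
theorem distr_lo (m : ℝ≥0) (x : L0 α) (l : ℝ≥0) (hm : distr x m ≠ ∞) :
    distr (lo m x) l = distr x l - distr x (max l m) := by
  have hx : Measurable (x : ℝ → ℝ) := (AEEqFun.stronglyMeasurable x).measurable
  have h1 : distr x (max l m) ≠ ∞ := ne_top_of_le_ne_top hm (distr_antitone x (le_max_right _ _))
  rw [lo, distr_cls]
  unfold distr at *
  rw [← measure_sdiff _ (measurableSet_lt measurable_const hx.abs).nullMeasurableSet h1]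
  · congr 1
    ext t
    simp only [Set.mem_ofPred_eq, NNReal.coe_max, max_lt_iff, Set.indicator_apply, Set.mem_sdiff,
      not_and, not_lt]
    split_ifs with h
    · simp [h]
    · have := l.2
      simp only [abs_zero]
      constructor
      · intro h'
        exact absurd h' (not_lt.2 this)
      · rintro ⟨h2, h3⟩
        exact absurd (h3 h2) h
  · intro t ht
    exact lt_of_le_of_lt (NNReal.coe_le_coe.2 (le_max_left l m)) ht

/-- Truncation by level depends only on the distribution, so smallness of the truncations of `x`
passes to those of `x*`. -/
theorem equimeasurable_hi {x y : L0 α} (h : Equimeasurable x y) (M : ℝ≥0) :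
    Equimeasurable (hi M x) (hi M y) := fun l => by
  rw [distr_hi, distr_hi, h]

theorem equimeasurable_lo {x y : L0 α} (h : Equimeasurable x y) {m : ℝ≥0} (hm : distr x m ≠ ∞) :
    Equimeasurable (lo m x) (lo m y) := fun l => by
  rw [distr_lo _ _ _ hm, distr_lo _ _ _ (by rwa [← h m]), h, h]

/-! ### The norm as an extended functional on `L⁰`. -/

namespace BanachFunctionSpace

variable (E : BanachFunctionSpace α)

/-- The norm of `E`, extended by `∞` to all of `L⁰`. -/
noncomputable def rho (x : L0 α) : ℝ≥0∞ := ⨅ h : x ∈ E.carrier, ENNReal.ofReal (E.norm ⟨x, h⟩)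

theorem rho_of_mem {x : L0 α} (h : x ∈ E.carrier) : E.rho x = ENNReal.ofReal (E.norm ⟨x, h⟩) := by
  simp [rho, h]

theorem rho_of_notMem {x : L0 α} (h : x ∉ E.carrier) : E.rho x = ∞ := by simp [rho, h]

theorem rho_coe (x : E.carrier) : E.rho x = ENNReal.ofReal (E.norm x) := E.rho_of_mem x.2

theorem norm_eq_toReal_rho (x : E.carrier) : E.norm x = (E.rho x).toReal := by
  rw [rho_coe, ENNReal.toReal_ofReal (apply_nonneg _ _)]

theorem mem_of_rho_ne_top {x : L0 α} (h : E.rho x ≠ ∞) : x ∈ E.carrier := by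
  by_contra h'
  exact h (E.rho_of_notMem h')

theorem rho_coe_ne_top (x : E.carrier) : E.rho x ≠ ∞ := by
  rw [rho_coe]
  exact ENNReal.ofReal_ne_top

theorem tendsto_norm_iff {ι : Type*} {l : Filter ι} (u : ι → E.carrier) :
    Tendsto (fun i => E.norm (u i)) l (𝓝 0) ↔ Tendsto (fun i => E.rho (u i)) l (𝓝 0) := by
  simp only [rho_coe]
  constructor
  · intro h
    simpa [Function.comp_def] using (ENNReal.continuous_ofReal.tendsto 0).comp h
  · intro h
    have := (ENNReal.tendsto_toReal ENNReal.zero_ne_top).comp h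
    simpa [Function.comp_def, ENNReal.toReal_ofReal (apply_nonneg E.norm _)] using this

theorem rho_zero : E.rho 0 = 0 := by
  rw [E.rho_of_mem E.carrier.zero_mem]
  have : E.norm ⟨0, E.carrier.zero_mem⟩ = 0 := map_zero E.norm
  rw [this, ENNReal.ofReal_zero]

theorem rho_mono {x y : L0 α} (h : ∀ᵐ t ∂(leb α), |x t| ≤ |y t|) : E.rho x ≤ E.rho y := by
  by_cases hy : y ∈ E.carrier
  · have hle : |x| ≤ |y| := by
      rw [← AEEqFun.coeFn_le]
      filter_upwards [h, AEEqFun.coeFn_abs x, AEEqFun.coeFn_abs y] with t ht h1 h2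
      rwa [h1, h2]
    obtain ⟨hx, hxy⟩ := E.ideal x ⟨y, hy⟩ hle
    rw [E.rho_of_mem hx, E.rho_of_mem hy]
    exact ENNReal.ofReal_le_ofReal hxy
  · rw [E.rho_of_notMem hy]
    exact le_top

theorem rho_add_le (x y : L0 α) : E.rho (x + y) ≤ E.rho x + E.rho y := by
  by_cases hx : x ∈ E.carrier
  · by_cases hy : y ∈ E.carrier
    · rw [E.rho_of_mem hx, E.rho_of_mem hy, E.rho_of_mem (E.carrier.add_mem hx hy),
        ← ENNReal.ofReal_add (apply_nonneg _ _) (apply_nonneg _ _)]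
      exact ENNReal.ofReal_le_ofReal (map_add_le_add E.norm ⟨x, hx⟩ ⟨y, hy⟩)
    · simp [E.rho_of_notMem hy]
  · simp [E.rho_of_notMem hx]

theorem rho_smul_le (c : ℝ) (x : L0 α) : E.rho (c • x) ≤ ENNReal.ofReal |c| * E.rho x := by
  rcases eq_or_ne c 0 with rfl | hc
  · rw [zero_smul, rho_zero]
    exact bot_le
  by_cases hx : x ∈ E.carrier
  · rw [E.rho_of_mem hx, E.rho_of_mem (E.carrier.smul_mem c hx),
      ← ENNReal.ofReal_mul (abs_nonneg c)]
    refine ENNReal.ofReal_le_ofReal (le_of_eq ?_)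
    exact map_smul_eq_mul E.norm c ⟨x, hx⟩
  · rw [E.rho_of_notMem hx, ENNReal.mul_top]
    · exact le_top
    · simpa using hc

theorem rho_smul (c : ℝ) (x : L0 α) : E.rho (c • x) = ENNReal.ofReal |c| * E.rho x := by
  rcases eq_or_ne c 0 with rfl | hc
  · simp [rho_zero]
  refine le_antisymm (E.rho_smul_le c x) ?_
  have h := E.rho_smul_le c⁻¹ (c • x)
  rw [smul_smul, inv_mul_cancel₀ hc, one_smul] at h
  calc ENNReal.ofReal |c| * E.rho x
      ≤ ENNReal.ofReal |c| * (ENNReal.ofReal |c⁻¹| * E.rho (c • x)) := by gcongr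
    _ = E.rho (c • x) := by
      rw [← mul_assoc, ← ENNReal.ofReal_mul (abs_nonneg c), ← abs_mul, mul_inv_cancel₀ hc]
      simp

variable {E}

theorem IsSymmetric.rho_eq (hE : E.IsSymmetric) {x y : L0 α} (h : Equimeasurable x y) :
    E.rho x = E.rho y := by
  by_cases hy : y ∈ E.carrier
  · obtain ⟨hx, hxy⟩ := hE x ⟨y, hy⟩ h
    rw [E.rho_of_mem hx, E.rho_of_mem hy, hxy]
  · by_cases hx : x ∈ E.carrier
    · exact absurd (hE y ⟨x, hx⟩ h.symm').1 hy
    · rw [E.rho_of_notMem hx, E.rho_of_notMem hy]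

theorem Fatou.rho_le_iSup (hF : E.Fatou) {u : ℕ → L0 α} {x : L0 α}
    (h0 : ∀ n, ∀ᵐ t ∂(leb α), 0 ≤ u n t) (hu : ∀ n, ∀ᵐ t ∂(leb α), u n t ≤ u (n + 1) t)
    (hx : ∀ᵐ t ∂(leb α), Tendsto (fun n => u n t) atTop (𝓝 (x t))) {c : ℝ≥0∞}
    (hc : ∀ n, E.rho (u n) ≤ c) : E.rho x ≤ c := by
  rcases eq_or_ne c ∞ with rfl | hctop
  · exact le_top
  have hmem : ∀ n, u n ∈ E.carrier := fun n =>
    E.mem_of_rho_ne_top (ne_top_of_le_ne_top hctop (hc n))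
  have hle : ∀ n, E.norm ⟨u n, hmem n⟩ ≤ c.toReal := fun n => by
    rw [E.norm_eq_toReal_rho]
    exact ENNReal.toReal_mono hctop (hc n)
  obtain ⟨hxE, hlim⟩ := hF (fun n => ⟨u n, hmem n⟩) x
    (fun n => by
      change (0 : L0 α) ≤ u n
      rw [← AEEqFun.coeFn_le]
      filter_upwards [h0 n, AEEqFun.coeFn_zero (μ := leb α) (β := ℝ)] with t h1 h2
      rw [h2]
      exact h1)
    (fun n => by
      change u n ≤ u (n + 1)
      rw [← AEEqFun.coeFn_le]
      exact hu n)
    ⟨c.toReal, by rintro _ ⟨n, rfl⟩; exact hle n⟩ hx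
  rw [E.rho_of_mem hxE]
  exact ENNReal.ofReal_le_of_le_toReal (le_of_tendsto' hlim hle)

end BanachFunctionSpace

end SymmSpace

/-! ### Step functions on equal cells and the seminorm they induce on `ℝⁿ`. -/

namespace SymmSpace

variable {α : ℝ≥0∞}

/-- The step function with `n` steps of width `1 / r` and heights `a 0, a 1, …`. -/
noncomputable def stepVal (r : ℝ) (n : ℕ) (a : ℕ → ℝ) (t : ℝ) : ℝ :=
  if ⌊t * r⌋₊ < n then a ⌊t * r⌋₊ else 0

theorem measurable_stepVal (r : ℝ) (n : ℕ) (a : ℕ → ℝ) : Measurable (stepVal r n a) := by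
  have h1 : Measurable fun t : ℝ => ⌊t * r⌋₊ := Nat.measurable_floor.comp (measurable_mul_const r)
  have h2 : Measurable fun i : ℕ => if i < n then a i else 0 := measurable_from_top
  exact h2.comp h1

/-- The steps. -/
def cell (r : ℝ) (i : ℕ) : Set ℝ := {t | ⌊t * r⌋₊ = i}

theorem measurableSet_cell (r : ℝ) (i : ℕ) : MeasurableSet (cell r i) :=
  (Nat.measurable_floor.comp (measurable_mul_const r)) (measurableSet_singleton i)

/-- The natural floor puts every negative number into cell `0`, hence `0 ≤ t`; the measure on `I`
does not see the difference. -/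
theorem mem_cell_iff {r : ℝ} (hr : 0 < r) (i : ℕ) {t : ℝ} (ht : 0 ≤ t) :
    t ∈ cell r i ↔ t ∈ Set.Ico (i / r) ((i + 1 : ℕ) / r) := by
  rw [Set.mem_Ico, div_le_iff₀ hr, lt_div_iff₀ hr]
  push_cast
  exact Nat.floor_eq_iff (by positivity)

theorem leb_cell {r : ℝ} (hr : 0 < r) {i : ℕ} (h : ENNReal.ofReal ((i + 1 : ℕ) / r) ≤ α) :
    leb α (cell r i) = ENNReal.ofReal r⁻¹ := by
  rw [leb, Measure.restrict_apply (measurableSet_cell r i)]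
  have : cell r i ∩ I α = Set.Ico (i / r) ((i + 1 : ℕ) / r) := by
    ext t
    constructor
    · rintro ⟨h1, h2⟩
      exact (mem_cell_iff hr i h2.1).1 h1
    · intro h1
      have h0 : 0 ≤ t := le_trans (by positivity) h1.1
      refine ⟨(mem_cell_iff hr i h0).2 h1, h0, lt_of_lt_of_le ?_ h⟩
      exact (ENNReal.ofReal_lt_ofReal_iff (h0.trans_lt h1.2)).2 h1.2
  rw [this, Real.volume_Ico]
  congr 1
  push_cast
  field_simp
  ring

namespace BanachFunctionSpace

variable (E : BanachFunctionSpace α)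

theorem cell_mem (hE : E.IsSymmetric) {r : ℝ} (hr : 0 < r) (i : ℕ) :
    ind α (cell r i) (measurableSet_cell r i) ∈ E.carrier := by
  refine E.mem_of_rho_ne_top (ne_top_of_le_ne_top (E.rho_coe_ne_top
    ⟨chi α ((i + 1 : ℕ) / r), E.chi_mem hE _⟩) (E.rho_mono ?_))
  filter_upwards [coeFn_ind α (cell r i) (measurableSet_cell r i),
    coeFn_ind α (Set.Ioo 0 ((i + 1 : ℕ) / r)) measurableSet_Ioo, ae_leb_pos α] with t h1 h2 h3
  rw [h1, chi, h2]
  by_cases ht : t ∈ cell r i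
  · rw [Set.indicator_of_mem ht, Set.indicator_of_mem]
    exact ⟨h3.1, ((mem_cell_iff hr i h3.1.le).1 ht).2⟩
  · rw [Set.indicator_of_notMem ht, abs_zero]
    exact abs_nonneg _

/-- Step functions, as a linear map into the space. -/
noncomputable def stepLin (hE : E.IsSymmetric) {r : ℝ} (hr : 0 < r) (n : ℕ) :
    (Fin n → ℝ) →ₗ[ℝ] E.carrier :=
  ∑ i : Fin n, (LinearMap.proj i).smulRight
    (⟨ind α (cell r i) (measurableSet_cell r i), E.cell_mem hE hr i⟩ : E.carrier)

theorem coeFn_stepLin (hE : E.IsSymmetric) {r : ℝ} (hr : 0 < r) (n : ℕ) (a : ℕ → ℝ) :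
    (E.stepLin hE hr n (fun i => a i) : L0 α) = cls α (stepVal r n a) (measurable_stepVal r n a) := by
  have h1 : ∀ v : Fin n → ℝ, (E.stepLin hE hr n v : L0 α) =
      ∑ i : Fin n, v i • ind α (cell r i) (measurableSet_cell r i) := fun v => by
    simp [stepLin]
  rw [h1]
  apply AEEqFun.ext
  have h2 : ∀ m : ℕ, (∑ i ∈ Finset.range m, a i • ind α (cell r i) (measurableSet_cell r i) : L0 α)
      =ᵐ[leb α] stepVal r m a := by
    intro m
    induction m with
    | zero =>
      filter_upwards [AEEqFun.coeFn_zero (μ := leb α) (β := ℝ)] with t ht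
      simpa [stepVal] using ht
    | succ m ih =>
      rw [Finset.sum_range_succ]
      filter_upwards [ih, AEEqFun.coeFn_add (∑ i ∈ Finset.range m,
        a i • ind α (cell r i) (measurableSet_cell r i))
        (a m • ind α (cell r m) (measurableSet_cell r m)),
        AEEqFun.coeFn_smul (a m) (ind α (cell r m) (measurableSet_cell r m)),
        coeFn_ind α (cell r m) (measurableSet_cell r m)] with t h3 h4 h5 h6
      rw [h4, Pi.add_apply, h3, h5, Pi.smul_apply, h6]
      by_cases h7 : ⌊t * r⌋₊ = m
      · have h8 : t ∈ cell r m := h7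
        simp [stepVal, h7, h8]
      · have h8 : t ∉ cell r m := h7
        rw [Set.indicator_of_notMem h8]
        simp only [stepVal, smul_zero, add_zero]
        have : ⌊t * r⌋₊ < m + 1 ↔ ⌊t * r⌋₊ < m := by omega
        simp [this]
  rw [Fin.sum_univ_eq_sum_range (fun i => a i • ind α (cell r i) (measurableSet_cell r i)) n]
  exact (h2 n).trans (coeFn_cls α (measurable_stepVal r n a)).symm

/-- The seminorm induced on `ℝⁿ` by step functions. -/
noncomputable def stepSeminorm (hE : E.IsSymmetric) {r : ℝ} (hr : 0 < r) (n : ℕ) :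
    Seminorm ℝ (Fin n → ℝ) := E.norm.comp (E.stepLin hE hr n)

theorem rho_stepVal (hE : E.IsSymmetric) {r : ℝ} (hr : 0 < r) (n : ℕ) (a : ℕ → ℝ) :
    E.rho (cls α (stepVal r n a) (measurable_stepVal r n a)) =
      ENNReal.ofReal (E.stepSeminorm hE hr n (fun i => a i)) := by
  rw [← E.coeFn_stepLin hE hr, rho_coe]
  rfl

theorem distr_stepVal {r : ℝ} (hr : 0 < r) (n : ℕ) (hn : ENNReal.ofReal (n / r) ≤ α) (a : ℕ → ℝ)
    (l : ℝ≥0) : distr (cls α (stepVal r n a) (measurable_stepVal r n a)) l =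
      ∑ i : Fin n, if (l : ℝ) < |a i| then ENNReal.ofReal r⁻¹ else 0 := by
  rw [distr_cls, Fin.sum_univ_eq_sum_range (fun i => if (l : ℝ) < |a i| then ENNReal.ofReal r⁻¹ else 0),
    ← Finset.sum_filter]
  have : {s | (l : ℝ) < |stepVal r n a s|} =
      ⋃ i ∈ (Finset.range n).filter (fun i => (l : ℝ) < |a i|), cell r i := by
    ext t
    simp only [Set.mem_ofPred_eq, stepVal, Set.mem_iUnion, Finset.mem_filter, Finset.mem_range, cell,
      exists_prop, exists_eq_right']
    split_ifs with h
    · simp [h]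
    · simp [h]
  rw [this, measure_biUnion_finset]
  · refine Finset.sum_congr rfl fun i hi => leb_cell hr (le_trans ?_ hn)
    have := Finset.mem_range.1 (Finset.mem_filter.1 hi).1
    gcongr
    omega
  · intro i _ j _ hij
    refine Set.disjoint_left.2 fun t (h1 : _ = i) (h2 : _ = j) => hij (h1.symm.trans h2)
  · exact fun i _ => measurableSet_cell r i

/-- All `n` cells fit into `I` and have the same measure, so permuting heights and changing signs
preserves the distribution function. -/
theorem stepSeminorm_symm (hE : E.IsSymmetric) {r : ℝ} (hr : 0 < r) (n : ℕ)
    (hn : ENNReal.ofReal (n / r) ≤ α) (v w : Fin n → ℝ) (σ : Equiv.Perm (Fin n))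
    (h : ∀ i, |v (σ i)| = |w i|) :
    E.stepSeminorm hE hr n v = E.stepSeminorm hE hr n w := by
  have hext : ∀ v : Fin n → ℝ, ∃ a : ℕ → ℝ, v = fun i : Fin n => a i := fun v =>
    ⟨fun i => if h : i < n then v ⟨i, h⟩ else 0, by ext i; simp⟩
  obtain ⟨a, rfl⟩ := hext v
  obtain ⟨b, rfl⟩ := hext w
  have h1 : E.rho (cls α (stepVal r n a) (measurable_stepVal r n a)) =
      E.rho (cls α (stepVal r n b) (measurable_stepVal r n b)) := by
    refine hE.rho_eq fun l => ?_
    rw [distr_stepVal hr n hn, distr_stepVal hr n hn, ← Equiv.sum_comp σ]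
    refine Finset.sum_congr rfl fun i _ => ?_
    rw [h]
  rw [E.rho_stepVal hE hr, E.rho_stepVal hE hr] at h1
  exact (ENNReal.ofReal_eq_ofReal_iff (apply_nonneg _ _) (apply_nonneg _ _)).1 h1

end BanachFunctionSpace

theorem lintegral_stepVal {r : ℝ} (hr : 0 < r) (n : ℕ) (a : ℕ → ℝ) (ha : ∀ i, 0 ≤ a i) {j : ℕ}
    (hj : j ≤ n) : ∫⁻ s in Set.Ioo 0 (j / r), ENNReal.ofReal (stepVal r n a s) =
      ENNReal.ofReal ((∑ i ∈ Finset.range j, a i) * r⁻¹) := by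
  rw [setLIntegral_congr Ioo_ae_eq_Ico]
  induction j with
  | zero => simp
  | succ j ih =>
    have h1 : Set.Ico 0 ((j + 1 : ℕ) / r) =
        Set.Ico 0 (j / r) ∪ Set.Ico (j / r) ((j + 1 : ℕ) / r) := by
      rw [Set.Ico_union_Ico_eq_Ico (by positivity)]
      gcongr
      exact Nat.le_succ j
    rw [h1, lintegral_union measurableSet_Ico, ih (by omega), Finset.sum_range_succ, add_mul,
      ENNReal.ofReal_add]
    · congr 1
      have h2 : ∀ s ∈ Set.Ico (j / r) ((j + 1 : ℕ) / r),
          ENNReal.ofReal (stepVal r n a s) = ENNReal.ofReal (a j) := by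
        intro s hs
        have h3 : ⌊s * r⌋₊ = j := (mem_cell_iff hr j (le_trans (by positivity) hs.1)).2 hs
        rw [stepVal, h3, if_pos (by omega)]
      rw [setLIntegral_congr_fun measurableSet_Ico h2, setLIntegral_const, Real.volume_Ico,
        ← ENNReal.ofReal_mul (ha j)]
      congr 2
      push_cast
      field_simp
      ring
    · exact mul_nonneg (Finset.sum_nonneg fun i _ => ha i) (by positivity)
    · exact mul_nonneg (ha j) (by positivity)
    · rw [Set.disjoint_left]
      exact fun s h1 h2 => absurd h1.2 (not_lt.2 h2.1)

end SymmSpace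

/-! ### Dyadic approximation from below and monotonicity under submajorization. -/

namespace SymmSpace

variable {α : ℝ≥0∞}

open Classical in
/-- The number of steps of width `2⁻ᵏ` used on `[0, α)`. -/
noncomputable def mesh (α : ℝ≥0∞) (k : ℕ) : ℕ := if α = 1 then 2 ^ k else k * 2 ^ k

theorem mesh_div_le (hα : α = 1 ∨ α = ∞) (k : ℕ) :
    ENNReal.ofReal ((mesh α k : ℝ) / 2 ^ k) ≤ α := by
  rcases hα with rfl | rfl
  · simp [mesh]
  · exact le_top

theorem mesh_mul_le (hα : α = 1 ∨ α = ∞) {k m : ℕ} (hkm : k ≤ m) :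
    mesh α k * 2 ^ (m - k) ≤ mesh α m := by
  obtain ⟨d, rfl⟩ := Nat.exists_eq_add_of_le hkm
  rw [Nat.add_sub_cancel_left]
  rcases hα with rfl | rfl
  · simp [mesh, pow_add]
  · simp only [mesh, ENNReal.top_ne_one, if_false, pow_add]
    rw [mul_assoc]
    exact Nat.mul_le_mul_right _ (by omega)

theorem eventually_lt_mesh (hα : α = 1 ∨ α = ∞) {t : ℝ} (ht : ENNReal.ofReal t < α) :
    ∀ᶠ k in atTop, ⌊t * 2 ^ k⌋₊ < mesh α k := by
  rcases hα with rfl | rfl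
  · refine Eventually.of_forall fun k => ?_
    have h1 : t < 1 := by simpa using ht
    rw [Nat.floor_lt' (by simp [mesh])]
    simp only [mesh, if_true]
    push_cast
    nlinarith [pow_pos (two_pos : (0 : ℝ) < 2) k]
  · obtain ⟨K, hK⟩ := exists_nat_gt t
    filter_upwards [eventually_ge_atTop (K + 1)] with k hk
    have hk' : ((K : ℝ) + 1) ≤ k := by exact_mod_cast hk
    have hm : mesh ∞ k = k * 2 ^ k := by simp [mesh]
    have hk0 : 0 < k := by omega
    have : mesh ∞ k ≠ 0 := by rw [hm]; positivity
    rw [Nat.floor_lt' this, hm]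
    push_cast
    gcongr
    linarith

/-- Heights of the lower step function of width `2⁻ᵏ` of a decreasing function. -/
noncomputable def lowSeq (f : ℝ → ℝ) (k : ℕ) (i : ℕ) : ℝ := f ((i + 1) / 2 ^ k)

/-- The lower step function of width `2⁻ᵏ` of a decreasing function. -/
noncomputable def low (α : ℝ≥0∞) (f : ℝ → ℝ) (k : ℕ) : ℝ → ℝ :=
  stepVal (2 ^ k) (mesh α k) (lowSeq f k)

section low

variable {f : ℝ → ℝ}

/-- Monotonicity is required only on `(0,∞)`: `x*(0)` may be `∞`, which `toReal` sends to `0`.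
Sampling at right endpoints avoids the point `0`. -/
theorem lowSeq_antitone (hf : AntitoneOn f (Set.Ioi 0)) (k : ℕ) : Antitone (lowSeq f k) :=
  fun i j hij => hf (Set.mem_Ioi.2 (by positivity)) (Set.mem_Ioi.2 (by positivity)) (by gcongr)

theorem low_nonneg (hf0 : ∀ t, 0 ≤ f t) (k : ℕ) (t : ℝ) : 0 ≤ low α f k t := by
  unfold low stepVal
  split_ifs
  · exact hf0 _
  · exact le_rfl

theorem low_le (hf : AntitoneOn f (Set.Ioi 0)) (hf0 : ∀ t, 0 ≤ f t) (k : ℕ) {t : ℝ} (ht : 0 < t) :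
    low α f k t ≤ f t := by
  unfold low stepVal
  split_ifs
  · refine hf ht (Set.mem_Ioi.2 (by positivity)) ?_
    rw [le_div_iff₀ (by positivity)]
    exact (Nat.lt_floor_add_one _).le
  · exact hf0 _

theorem low_le_succ (hα : α = 1 ∨ α = ∞) (hf : AntitoneOn f (Set.Ioi 0)) (hf0 : ∀ t, 0 ≤ f t)
    (k : ℕ) (t : ℝ) : low α f k t ≤ low α f (k + 1) t := by
  have hdiv : ⌊t * 2 ^ (k + 1)⌋₊ / 2 = ⌊t * 2 ^ k⌋₊ := by
    rw [← Nat.floor_div_natCast]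
    congr 1
    push_cast
    rw [pow_succ]
    ring
  by_cases h : ⌊t * 2 ^ k⌋₊ < mesh α k
  · have hm := mesh_mul_le hα (Nat.le_succ k)
    rw [Nat.succ_sub (le_refl k), Nat.sub_self, pow_succ, pow_zero, one_mul] at hm
    have h' : ⌊t * 2 ^ (k + 1)⌋₊ < mesh α (k + 1) := lt_of_lt_of_le (by omega) hm
    rw [low, stepVal, if_pos h, low, stepVal, if_pos h']
    refine hf (Set.mem_Ioi.2 (by positivity)) (Set.mem_Ioi.2 (by positivity)) ?_
    rw [div_le_div_iff₀ (by positivity) (by positivity)]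
    have h3 : ⌊t * 2 ^ (k + 1)⌋₊ + 1 ≤ (⌊t * 2 ^ k⌋₊ + 1) * 2 := by omega
    have h4 : ((⌊t * 2 ^ (k + 1)⌋₊ : ℝ) + 1) ≤ ((⌊t * 2 ^ k⌋₊ : ℝ) + 1) * 2 := by exact_mod_cast h3
    calc _ ≤ (((⌊t * 2 ^ k⌋₊ : ℝ) + 1) * 2) * 2 ^ k := by gcongr
      _ = _ := by ring
  · rw [low, stepVal, if_neg h]
    exact low_nonneg hf0 _ _

/-- A decreasing function has only countably many discontinuities, and the right endpoints of the
cells containing `t` converge to `t`. -/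
theorem tendsto_low (hα : α = 1 ∨ α = ∞) (hf : AntitoneOn f (Set.Ioi 0)) :
    ∀ᵐ t ∂(leb α), Tendsto (fun k => low α f k t) atTop (𝓝 (f t)) := by
  have hc : ∀ᵐ t ∂(leb α), ¬ (t ∈ Set.Ioi (0 : ℝ) ∧ ¬ ContinuousWithinAt f (Set.Ioi 0) t) := by
    refine ae_restrict_of_ae ?_
    rw [ae_iff]
    simpa using hf.countable_not_continuousWithinAt.measure_zero volume
  filter_upwards [hc, ae_leb_pos α] with t h1 ht
  have hcont : ContinuousAt f t := by
    have : ContinuousWithinAt f (Set.Ioi 0) t := by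
      by_contra h
      exact h1 ⟨ht.1, h⟩
    exact this.continuousAt (Ioi_mem_nhds ht.1)
  have hlim : Tendsto (fun k : ℕ => ((⌊t * 2 ^ k⌋₊ : ℝ) + 1) / 2 ^ k) atTop (𝓝 t) := by
    have h2 : Tendsto (fun k : ℕ => t + (1 / 2 : ℝ) ^ k) atTop (𝓝 t) := by
      simpa using (tendsto_pow_atTop_nhds_zero_of_lt_one (r := (1 / 2 : ℝ)) (by norm_num)
        (by norm_num)).const_add t
    refine tendsto_of_tendsto_of_tendsto_of_le_of_le tendsto_const_nhds h2 (fun k => ?_) fun k => ?_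
    · change t ≤ _
      rw [le_div_iff₀ (by positivity)]
      exact (Nat.lt_floor_add_one _).le
    · change _ ≤ t + (1 / 2 : ℝ) ^ k
      rw [div_le_iff₀ (by positivity), add_mul, ← mul_pow]
      have := Nat.floor_le (a := t * 2 ^ k) (mul_nonneg ht.1.le (by positivity))
      norm_num
      exact this
  refine (hcont.tendsto.comp hlim).congr' ?_
  filter_upwards [eventually_lt_mesh hα ht.2] with k hk
  rw [low, stepVal, if_pos hk]
  rfl

end low

theorem sum_range_div {q : ℕ} (hq : 0 < q) (a : ℕ → ℝ) (j : ℕ) :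
    ∑ i ∈ Finset.range (j * q), a (i / q) = (∑ i ∈ Finset.range j, a i) * q := by
  induction j with
  | zero => simp
  | succ j ih =>
    rw [Nat.succ_mul, Finset.sum_range_add, ih, Finset.sum_range_succ, add_mul]
    congr 1
    rw [Finset.sum_congr rfl (g := fun _ => a j), Finset.sum_const, Finset.card_range, nsmul_eq_mul,
      mul_comm]
    intro i hi
    rw [Nat.mul_comm, Nat.mul_add_div hq, Nat.div_eq_of_lt (Finset.mem_range.1 hi), add_zero]

/-- Refinement of a coarse comparison of partial sums. -/
theorem partial_sums_le_of_coarse {q n : ℕ} (hq : 0 < q) {a b : ℕ → ℝ} (hb : Antitone b)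
    (hb0 : ∀ i, 0 ≤ b i) (han : ∀ i, n ≤ i → a i = 0)
    (h : ∀ j ≤ n, (∑ i ∈ Finset.range j, a i) * q ≤ ∑ i ∈ Finset.range (j * q), b i) (j : ℕ) :
    ∑ i ∈ Finset.range j, a (i / q) ≤ ∑ i ∈ Finset.range j, b i := by
  have h' : ∀ j, ∑ i ∈ Finset.range (j * q), a (i / q) ≤ ∑ i ∈ Finset.range (j * q), b i := by
    intro j
    rw [sum_range_div hq]
    rcases le_total j n with hj | hj
    · exact h j hj
    · have h1 : ∑ i ∈ Finset.range j, a i = ∑ i ∈ Finset.range n, a i := by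
        rw [← Finset.sum_range_add_sum_Ico _ hj, Finset.sum_eq_zero (s := Finset.Ico n j), add_zero]
        exact fun i hi => han i (Finset.mem_Ico.1 hi).1
      rw [h1]
      refine (h n le_rfl).trans (Finset.sum_le_sum_of_subset_of_nonneg ?_ fun i _ _ => hb0 i)
      exact Finset.range_mono (Nat.mul_le_mul_right _ hj)
  refine partial_sums_le_of_block (p := j / q * q) (q := (j / q + 1) * q) (c := a (j / q)) hb ?_
    (h' _) (h' _) (Nat.div_mul_le_self j q) ?_
  · intro i h1 h2
    congr 1
    exact Nat.div_eq_of_lt_le h1 h2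
  · rw [add_mul, one_mul, mul_comm]
    exact (Nat.lt_mul_div_succ j hq).le.trans_eq (by ring)

namespace BanachFunctionSpace

variable {E : BanachFunctionSpace α}

/-- The factor `θ < 1` buys room: the integrals of the lower steps of `g` only converge to those of
`g`, but a strict inequality at finitely many coarse nodes survives on a fine enough mesh. There
both functions are vectors and the inequality on `ℝⁿ` applies. -/
theorem rho_low_le (hE : E.IsSymmetric) (hα : α = 1 ∨ α = ∞) {f g : ℝ → ℝ}
    (hg : Measurable g) (hf0 : ∀ t, 0 ≤ f t) (hg0 : ∀ t, 0 ≤ g t)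
    (hfa : AntitoneOn f (Set.Ioi 0)) (hga : AntitoneOn g (Set.Ioi 0))
    (h : ∀ t : ℝ, 0 < t → ENNReal.ofReal t ≤ α →
      ∫⁻ s in Set.Ioo 0 t, ENNReal.ofReal (f s) ≤ ∫⁻ s in Set.Ioo 0 t, ENNReal.ofReal (g s))
    (k : ℕ) {θ : ℝ} (hθ0 : 0 < θ) (hθ : θ < 1) :
    ENNReal.ofReal θ * E.rho (cls α (low α f k) (measurable_stepVal _ _ _)) ≤
      E.rho (cls α g hg) := by
  have hpow : ∀ m : ℕ, (0 : ℝ) < 2 ^ m := fun m => by positivity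
  -- comparison of the integrals at the coarse nodes
  have hev : ∀ᶠ m in atTop, ∀ j ∈ Finset.range (mesh α k + 1),
      θ * (∑ i ∈ Finset.range j, lowSeq f k i) * (2 ^ k)⁻¹ ≤
        (∑ i ∈ Finset.range (j * 2 ^ (m - k)), lowSeq g m i) * (2 ^ m)⁻¹ := by
    rw [eventually_all_finset]
    intro j hj
    have hjm : j ≤ mesh α k := Nat.lt_succ_iff.1 (Finset.mem_range.1 hj)
    -- With a zero sum, shrinking by `θ` gives no strict inequality, but the claim is trivial.
    rcases (Finset.sum_nonneg (s := Finset.range j) (f := lowSeq f k)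
      fun i _ => hf0 _).eq_or_lt with h0 | hpos
    · filter_upwards with m
      rw [← h0, mul_zero, zero_mul]
      exact mul_nonneg (Finset.sum_nonneg fun i _ => hg0 _) (by positivity)
    have hj0 : 0 < j := by
      rcases Nat.eq_zero_or_pos j with rfl | hj0
      · simp at hpos
      · exact hj0
    have hT : (0 : ℝ) < j / 2 ^ k := by positivity
    have hTα : ENNReal.ofReal ((j : ℝ) / 2 ^ k) ≤ α := by
      refine le_trans ?_ (mesh_div_le hα k)
      gcongr
    have hlim : Tendsto (fun m => ∫⁻ s in Set.Ioo 0 ((j : ℝ) / 2 ^ k), ENNReal.ofReal (low α g m s))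
        atTop (𝓝 (∫⁻ s in Set.Ioo 0 ((j : ℝ) / 2 ^ k), ENNReal.ofReal (g s))) := by
      refine lintegral_tendsto_of_tendsto_of_monotone
        (fun m => (measurable_stepVal _ _ _).ennreal_ofReal.aemeasurable) ?_ ?_
      · filter_upwards with s
        exact monotone_nat_of_le_succ fun m =>
          ENNReal.ofReal_le_ofReal (low_le_succ hα hga hg0 m s)
      · have hsub : volume.restrict (Set.Ioo 0 ((j : ℝ) / 2 ^ k)) ≤ leb α := by
          have : Set.Ioo 0 ((j : ℝ) / 2 ^ k) ⊆ I α := fun s hs => ⟨hs.1.le,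
            ((ENNReal.ofReal_lt_ofReal_iff hT).2 hs.2).trans_le hTα⟩
          exact Measure.restrict_mono this le_rfl
        filter_upwards [ae_mono hsub (tendsto_low hα hga)] with s hs
        exact (ENNReal.continuous_ofReal.tendsto _).comp hs
    have hlt : ENNReal.ofReal (θ * (∑ i ∈ Finset.range j, lowSeq f k i) * (2 ^ k)⁻¹) <
        ∫⁻ s in Set.Ioo 0 ((j : ℝ) / 2 ^ k), ENNReal.ofReal (g s) := by
      refine lt_of_lt_of_le (b := ENNReal.ofReal ((∑ i ∈ Finset.range j, lowSeq f k i) * (2 ^ k)⁻¹))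
        ?_ (le_trans ?_ (h _ hT hTα))
      · rw [ENNReal.ofReal_lt_ofReal_iff (by positivity)]
        have : (0 : ℝ) < (2 ^ k)⁻¹ := by positivity
        nlinarith [mul_pos hpos this]
      · rw [← lintegral_stepVal (hpow k) (mesh α k) (lowSeq f k) (fun i => hf0 _) hjm]
        refine setLIntegral_mono' measurableSet_Ioo fun s hs => ENNReal.ofReal_le_ofReal ?_
        exact low_le (α := α) hfa hf0 k hs.1
    filter_upwards [hlim.eventually (lt_mem_nhds hlt), eventually_ge_atTop k] with m hm hkm
    have hnode : (j : ℝ) / 2 ^ k = ((j * 2 ^ (m - k) : ℕ) : ℝ) / 2 ^ m := by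
      rw [div_eq_div_iff (hpow k).ne' (hpow m).ne']
      push_cast
      rw [mul_assoc, ← pow_add, Nat.sub_add_cancel hkm]
    rw [hnode] at hm
    unfold low at hm
    rw [lintegral_stepVal (hpow m) (mesh α m) (lowSeq g m) (fun i => hg0 _)
      ((Nat.mul_le_mul_right _ hjm).trans (mesh_mul_le hα hkm))] at hm
    exact ((ENNReal.ofReal_lt_ofReal_iff').1 hm).1.le
  obtain ⟨m, hm, hkm⟩ := (hev.and (eventually_ge_atTop k)).exists
  -- comparison of vectors on the fine mesh
  have hq : 0 < 2 ^ (m - k) := by positivity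
  -- Each coarse height is repeated `2 ^ (m - k)` times on the fine mesh. Inside such a block `a` is
  -- constant, so comparison at the coarse nodes suffices.
  set a : ℕ → ℝ := fun i => if i < mesh α k then θ * lowSeq f k i else 0 with ha
  have haa : Antitone a := by
    intro i j hij
    simp only [ha]
    split_ifs with h1 h2
    · exact mul_le_mul_of_nonneg_left (lowSeq_antitone hfa k hij) hθ0.le
    · omega
    · exact mul_nonneg hθ0.le (hf0 _)
    · exact le_rfl
  have ha0 : ∀ i, 0 ≤ a i := by
    intro i
    simp only [ha]
    split_ifs
    · exact mul_nonneg hθ0.le (hf0 _)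
    · exact le_rfl
  have hpart := partial_sums_le_of_coarse (n := mesh α k) hq (a := a) (lowSeq_antitone hga m)
    (fun i => hg0 _) (fun i hi => if_neg (not_lt.2 hi)) (fun j hj => by
      have h1 := hm j (Finset.mem_range.2 (Nat.lt_succ_iff.2 hj))
      have h2 : ∑ i ∈ Finset.range j, a i = θ * ∑ i ∈ Finset.range j, lowSeq f k i := by
        rw [Finset.mul_sum]
        refine Finset.sum_congr rfl fun i hi => ?_
        exact if_pos ((Finset.mem_range.1 hi).trans_le hj)
      have h3 : (2 : ℝ) ^ m = 2 ^ (m - k) * 2 ^ k := by rw [← pow_add, Nat.sub_add_cancel hkm]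
      rw [h2]
      push_cast
      rw [h3, mul_inv, ← mul_assoc] at h1
      have h4 := le_of_mul_le_mul_right h1 (by positivity)
      rwa [le_mul_inv_iff₀ (by positivity)] at h4)
  have hN := seminorm_le_of_partial_sums (E.stepSeminorm hE (hpow m) (mesh α m))
    (E.stepSeminorm_symm hE (hpow m) (mesh α m) (mesh_div_le hα m))
    (fun i => a (i / 2 ^ (m - k))) (lowSeq g m)
    (fun i j hij => haa (Nat.div_le_div_right hij)) (fun i => ha0 _) (fun j _ => hpart j)
  have hN' := ENNReal.ofReal_le_ofReal hN
  rw [← E.rho_stepVal hE (hpow m) _ (fun i => a (i / 2 ^ (m - k))),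
    ← E.rho_stepVal hE (hpow m)] at hN'
  have hleft : ∀ t, stepVal (2 ^ m) (mesh α m) (fun i => a (i / 2 ^ (m - k))) t =
      θ * low α f k t := by
    intro t
    have hdiv : ⌊t * 2 ^ m⌋₊ / 2 ^ (m - k) = ⌊t * 2 ^ k⌋₊ := by
      rw [← Nat.floor_div_natCast]
      congr 1
      push_cast
      rw [div_eq_iff (hpow _).ne', mul_assoc, ← pow_add, Nat.add_sub_cancel' hkm]
    simp only [stepVal, low, hdiv, ha]
    by_cases h1 : ⌊t * 2 ^ k⌋₊ < mesh α k
    · have h2 : ⌊t * 2 ^ m⌋₊ < mesh α m := by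
        refine lt_of_lt_of_le ?_ (mesh_mul_le hα hkm)
        rw [← Nat.div_lt_iff_lt_mul hq, hdiv]
        exact h1
      rw [if_pos h1, if_pos h2, if_pos h1]
    · simp [h1]
  calc ENNReal.ofReal θ * E.rho (cls α (low α f k) (measurable_stepVal _ _ _))
      = E.rho (θ • cls α (low α f k) (measurable_stepVal _ _ _)) := by
        rw [E.rho_smul θ, abs_of_pos hθ0]
    _ ≤ E.rho (cls α (stepVal (2 ^ m) (mesh α m) fun i => a (i / 2 ^ (m - k)))
          (measurable_stepVal _ _ _)) := by
        refine E.rho_mono ?_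
        filter_upwards [AEEqFun.coeFn_smul θ (cls α (low α f k) (measurable_stepVal _ _ _)),
          coeFn_cls α (measurable_stepVal (2 ^ m) (mesh α m) fun i => a (i / 2 ^ (m - k))),
          coeFn_cls α (f := low α f k) (measurable_stepVal _ _ _)] with t h1 h2 h3
        rw [h1, h2, Pi.smul_apply, h3, hleft, smul_eq_mul]
    _ ≤ E.rho (cls α (low α g m) (measurable_stepVal _ _ _)) := hN'
    _ ≤ E.rho (cls α g hg) := by
        refine E.rho_mono ?_
        filter_upwards [coeFn_cls α (f := low α g m) (measurable_stepVal _ _ _), coeFn_cls α hg,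
          ae_leb_pos α] with t h1 h2 h3
        rw [h1, h2, abs_of_nonneg (low_nonneg hg0 m t), abs_of_nonneg (hg0 t)]
        exact low_le hga hg0 m h3.1

/-- A symmetric space with the Fatou property is monotone with respect to the
Hardy-Littlewood-Pólya relation. -/
theorem rho_le_of_lintegral_le (hE : E.IsSymmetric) (hF : E.Fatou) (hα : α = 1 ∨ α = ∞)
    {f g : ℝ → ℝ} (hf : Measurable f) (hg : Measurable g) (hf0 : ∀ t, 0 ≤ f t) (hg0 : ∀ t, 0 ≤ g t)
    (hfa : AntitoneOn f (Set.Ioi 0)) (hga : AntitoneOn g (Set.Ioi 0))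
    (h : ∀ t : ℝ, 0 < t → ENNReal.ofReal t ≤ α →
      ∫⁻ s in Set.Ioo 0 t, ENNReal.ofReal (f s) ≤ ∫⁻ s in Set.Ioo 0 t, ENNReal.ofReal (g s)) :
    E.rho (cls α f hf) ≤ E.rho (cls α g hg) := by
  have hlow : ∀ k, cls α (low α f k) (measurable_stepVal _ _ _) =ᵐ[leb α] low α f k :=
    fun k => coeFn_cls α _
  refine hF.rho_le_iSup (u := fun k => cls α (low α f k) (measurable_stepVal _ _ _)) ?_ ?_ ?_ ?_
  · intro k
    filter_upwards [hlow k] with t ht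
    rw [ht]
    exact low_nonneg hf0 k t
  · intro k
    filter_upwards [hlow k, hlow (k + 1)] with t h1 h2
    rw [h1, h2]
    exact low_le_succ hα hfa hf0 k t
  · filter_upwards [ae_all_iff.2 hlow, coeFn_cls α hf, tendsto_low hα hfa] with t h1 h2 h3
    rw [h2]
    exact h3.congr fun k => (h1 k).symm
  · intro k
    -- Let `θ → 1`; the shift by `2` keeps `θ` positive at `n = 0`.
    have hlim : Tendsto (fun n : ℕ => ENNReal.ofReal (1 - 1 / ((n : ℝ) + 2)) *
        E.rho (cls α (low α f k) (measurable_stepVal _ _ _))) atTop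
        (𝓝 (ENNReal.ofReal 1 * E.rho (cls α (low α f k) (measurable_stepVal _ _ _)))) := by
      refine ENNReal.Tendsto.mul_const ((ENNReal.continuous_ofReal.tendsto _).comp ?_)
        (Or.inl (by simp))
      have h1 : Tendsto (fun n : ℕ => (n : ℝ) + 2) atTop atTop :=
        tendsto_atTop_add_const_right _ _ tendsto_natCast_atTop_atTop
      simpa using (h1.inv_tendsto_atTop).const_sub 1
    rw [ENNReal.ofReal_one, one_mul] at hlim
    refine le_of_tendsto' hlim fun n => rho_low_le hE hα hg hf0 hg0 hfa hga h k ?_ ?_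
    · rw [sub_pos, div_lt_one (by positivity)]
      linarith [(Nat.cast_nonneg n : (0 : ℝ) ≤ n)]
    · have : (0 : ℝ) < 1 / ((n : ℝ) + 2) := by positivity
      linarith

end BanachFunctionSpace

end SymmSpace

/-! ### The maximal function and convergence of rearrangements. -/

namespace SymmSpace

variable {α : ℝ≥0∞}

theorem lintegral_Ioo_split (f : ℝ → ℝ≥0∞) {a t : ℝ} (ha : 0 < a) (hat : a ≤ t) :
    ∫⁻ s in Set.Ioo 0 t, f s = (∫⁻ s in Set.Ioo 0 a, f s) + ∫⁻ s in Set.Ico a t, f s := by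
  rw [← Set.Ioo_union_Ico_eq_Ioo ha hat, lintegral_union measurableSet_Ico]
  exact Set.disjoint_left.2 fun s h1 h2 => absurd h1.2 (not_lt.2 h2.1)

theorem setLIntegral_Ico_le {f : ℝ → ℝ≥0∞} {a t : ℝ} {c : ℝ≥0∞}
    (h : ∀ s ∈ Set.Ico a t, f s ≤ c) :
    ∫⁻ s in Set.Ico a t, f s ≤ c * ENNReal.ofReal (t - a) := by
  refine (setLIntegral_mono' measurableSet_Ico h).trans ?_
  rw [setLIntegral_const, Real.volume_Ico]

theorem setLIntegral_Ioo_le {f : ℝ → ℝ≥0∞} {t : ℝ} {c : ℝ≥0∞}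
    (h : ∀ s ∈ Set.Ioo 0 t, f s ≤ c) :
    ∫⁻ s in Set.Ioo 0 t, f s ≤ c * ENNReal.ofReal t := by
  refine (setLIntegral_mono' measurableSet_Ioo h).trans ?_
  rw [setLIntegral_const, Real.volume_Ioo, sub_zero]

theorem maxFun_le_iff (x : L0 α) {t : ℝ} (ht : 0 < t) (c : ℝ≥0∞) :
    maxFun x t ≤ c ↔ ∫⁻ s in Set.Ioo 0 t, rearr x s ≤ ENNReal.ofReal t * c :=
  ENNReal.inv_mul_le_iff (ENNReal.ofReal_pos.2 ht).ne' ENNReal.ofReal_ne_top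

theorem ofReal_mul_maxFun (x : L0 α) {t : ℝ} (ht : 0 < t) :
    ENNReal.ofReal t * maxFun x t = ∫⁻ s in Set.Ioo 0 t, rearr x s := by
  rw [maxFun, ← mul_assoc,
    ENNReal.mul_inv_cancel (ENNReal.ofReal_pos.2 ht).ne' ENNReal.ofReal_ne_top, one_mul]

theorem HLP.lintegral_le {x y : L0 α} (h : HLP x y) {t : ℝ} (ht : 0 < t) :
    ∫⁻ s in Set.Ioo 0 t, rearr x s ≤ ∫⁻ s in Set.Ioo 0 t, rearr y s := by
  rw [← ofReal_mul_maxFun x ht, ← ofReal_mul_maxFun y ht]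
  exact mul_le_mul_right (h t ht) _

theorem rearr_le_maxFun (x : L0 α) {t : ℝ} (ht : 0 < t) : rearr x t ≤ maxFun x t := by
  have h : ∫⁻ _ in Set.Ioo 0 t, rearr x t ≤ ∫⁻ s in Set.Ioo 0 t, rearr x s :=
    setLIntegral_mono' measurableSet_Ioo fun s hs => rearr_antitone x hs.2.le
  rw [setLIntegral_const, Real.volume_Ioo, sub_zero, ← ofReal_mul_maxFun x ht, mul_comm] at h
  exact (ENNReal.mul_le_mul_iff_right (ENNReal.ofReal_pos.2 ht).ne' ENNReal.ofReal_ne_top).1 h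

theorem maxFun_antitoneOn (x : L0 α) : AntitoneOn (maxFun x) (Set.Ioi 0) := by
  intro t (ht : 0 < t) s (hs : 0 < s) hts
  rw [maxFun_le_iff x hs, lintegral_Ioo_split _ ht hts, ← ofReal_mul_maxFun x ht]
  have h : ∫⁻ r in Set.Ico t s, rearr x r ≤ maxFun x t * ENNReal.ofReal (s - t) :=
    setLIntegral_Ico_le fun r hr => (rearr_antitone x hr.1).trans (rearr_le_maxFun x ht)
  refine (add_le_add le_rfl h).trans_eq ?_
  rw [mul_comm _ (ENNReal.ofReal _), ← add_mul, ← ENNReal.ofReal_add ht.le (sub_nonneg.2 hts),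
    add_sub_cancel]

/-- The maximal function is either infinite everywhere or finite everywhere. -/
theorem maxFun_ne_top {x : L0 α} {s t : ℝ} (hs : 0 < s)
    (ht : 0 < t) (h : maxFun x s ≠ ∞) : maxFun x t ≠ ∞ := by
  rcases le_total s t with hst | hst
  · exact ne_top_of_le_ne_top h (maxFun_antitoneOn x hs ht hst)
  · have h1 : ∫⁻ r in Set.Ioo 0 s, rearr x r ≠ ∞ := by
      rw [← ofReal_mul_maxFun x hs]
      exact ENNReal.mul_ne_top ENNReal.ofReal_ne_top h
    rw [maxFun]
    refine ENNReal.mul_ne_top (ENNReal.inv_ne_top.2 (ENNReal.ofReal_pos.2 ht).ne') ?_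
    exact ne_top_of_le_ne_top h1 (lintegral_mono_set (Set.Ioo_subset_Ioo_right hst))

/-- Split the average at a `T` beyond which `x* ≤ ε/2`; the finite integral over `(0,T)` becomes
negligible after division by a large `s`. -/
theorem tendsto_maxFun {x : L0 α} (h1 : maxFun x 1 ≠ ∞)
    (h : Tendsto (rearr x) atTop (𝓝 0)) : Tendsto (maxFun x) atTop (𝓝 0) := by
  rw [ENNReal.tendsto_nhds_zero] at h ⊢
  intro ε hε
  have hε2 : 0 < ε / 2 := ENNReal.half_pos hε.ne'
  obtain ⟨T, hT, hT1⟩ := ((h (ε / 2) hε2).and (eventually_ge_atTop 1)).exists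
  have hT0 : 0 < T := lt_of_lt_of_le one_pos hT1
  have hA : maxFun x T ≠ ∞ := ne_top_of_le_ne_top h1
    (maxFun_antitoneOn x (Set.mem_Ioi.2 one_pos) hT0 hT1)
  have hA' : ENNReal.ofReal T * maxFun x T ≠ ∞ := ENNReal.mul_ne_top ENNReal.ofReal_ne_top hA
  obtain ⟨n, hn, hnlt⟩ := ENNReal.exists_nnreal_pos_mul_lt hA' hε2.ne'
  filter_upwards [eventually_ge_atTop T, eventually_ge_atTop ((n : ℝ)⁻¹)] with s hs hsn
  have hs0 : 0 < s := hT0.trans_le hs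
  rw [maxFun_le_iff x hs0, lintegral_Ioo_split _ hT0 hs, ← ofReal_mul_maxFun x hT0]
  have h2 : ∫⁻ r in Set.Ico T s, rearr x r ≤ ε / 2 * ENNReal.ofReal (s - T) :=
    setLIntegral_Ico_le fun r hr => (rearr_antitone x hr.1).trans hT
  have h3 : ENNReal.ofReal T * maxFun x T ≤ ENNReal.ofReal s * (ε / 2) := by
    calc ENNReal.ofReal T * maxFun x T
        ≤ (ENNReal.ofReal s * n) * (ENNReal.ofReal T * maxFun x T) := by
          refine le_mul_of_one_le_left bot_le ?_
          rw [← ENNReal.ofReal_coe_nnreal, ← ENNReal.ofReal_mul hs0.le, ENNReal.one_le_ofReal]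
          have hn' : (0 : ℝ) < n := hn
          exact (inv_le_iff_one_le_mul₀ hn').1 hsn
      _ = ENNReal.ofReal s * (n * (ENNReal.ofReal T * maxFun x T)) := by ring
      _ ≤ ENNReal.ofReal s * (ε / 2) := by gcongr
  calc _ ≤ ENNReal.ofReal s * (ε / 2) + ENNReal.ofReal s * (ε / 2) := by
        refine add_le_add h3 (h2.trans ?_)
        rw [mul_comm]
        gcongr
        linarith
    _ = ENNReal.ofReal s * ε := by rw [← mul_add, ENNReal.add_halves]

theorem distr_ne_top (hα : α = 1 ∨ α = ∞) {x : L0 α}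
    (h : α = ∞ → Tendsto (rearr x) atTop (𝓝 0)) {l : ℝ≥0} (hl : 0 < l) : distr x l ≠ ∞ := by
  rcases hα with rfl | rfl
  · exact ne_top_of_le_ne_top ENNReal.one_ne_top (distr_le x l)
  · obtain ⟨t, ht⟩ := ((ENNReal.tendsto_nhds_zero.1 (h rfl) l (by exact_mod_cast hl))).exists
    exact ne_top_of_le_ne_top ENNReal.ofReal_ne_top ((rearr_le_iff x l t).1 ht)

theorem coeFn_smul_chi (c t : ℝ) :
    (c • chi α t : L0 α) =ᵐ[leb α] (Set.Ioo 0 t).indicator fun _ => c := by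
  filter_upwards [AEEqFun.coeFn_smul c (chi α t), coeFn_ind α (Set.Ioo 0 t) measurableSet_Ioo]
    with s h1 h2
  rw [h1, Pi.smul_apply, chi, h2]
  by_cases hs : s ∈ Set.Ioo 0 t <;> simp [hs]

theorem distr_smul_chi_le (c t : ℝ) (l : ℝ≥0) :
    distr (c • chi α t : L0 α) l ≤ ENNReal.ofReal t := by
  calc distr (c • chi α t : L0 α) l ≤ leb α (Set.Ioo 0 t) := by
        refine measure_mono_ae ?_
        filter_upwards [coeFn_smul_chi (α := α) c t] with s hs (hls : (l : ℝ) < |_|)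
        rw [hs] at hls
        change s ∈ Set.Ioo 0 t
        by_contra h
        rw [Set.indicator_of_notMem h, abs_zero] at hls
        exact absurd hls (not_lt.2 l.2)
    _ ≤ ENNReal.ofReal t := by
        refine (Measure.restrict_apply_le _ _).trans ?_
        rw [Real.volume_Ioo, sub_zero]

theorem rearr_smul_chi_of_le (c : ℝ) {t s : ℝ} (h : t ≤ s) : rearr (c • chi α t : L0 α) s = 0 := by
  have := rearr_le_of_distr_le (l := 0)
    ((distr_smul_chi_le (α := α) c t 0).trans (ENNReal.ofReal_le_ofReal h))
  simpa using this

theorem rearr_smul_chi_le (c : ℝ≥0) (t s : ℝ) : rearr ((c : ℝ) • chi α t : L0 α) s ≤ c := by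
  refine rearr_le_of_distr_le (le_of_eq_of_le ?_ bot_le)
  rw [distr, bot_eq_zero, measure_eq_zero_iff_ae_notMem]
  filter_upwards [coeFn_smul_chi (α := α) c t] with r hr (hlr : (c : ℝ) < |_|)
  rw [hr] at hlr
  refine absurd hlr (not_lt.2 ?_)
  by_cases h : r ∈ Set.Ioo 0 t
  · rw [Set.indicator_of_mem h, NNReal.abs_eq]
  · rw [Set.indicator_of_notMem h, abs_zero]
    exact c.2

/-- Pointwise convergence of the rearrangements of a sequence dominated by a function whose
distribution function is finite. -/
theorem tendsto_rearr_of_ae {x : L0 α} (hx : ∀ l : ℝ≥0, 0 < l → distr x l ≠ ∞) {u : ℕ → L0 α}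
    (hux : ∀ n, ∀ᵐ t ∂(leb α), |u n t| ≤ |x t|)
    (hu : ∀ᵐ t ∂(leb α), Tendsto (fun n => u n t) atTop (𝓝 0)) {t : ℝ} (ht : 0 < t) :
    Tendsto (fun n => rearr (u n) t) atTop (𝓝 0) := by
  have hm : ∀ y : L0 α, ∀ l : ℝ≥0, MeasurableSet {s | (l : ℝ) < |y s|} := fun y l =>
    measurableSet_lt measurable_const (AEEqFun.stronglyMeasurable y).measurable.abs
  rw [ENNReal.tendsto_nhds_zero]
  intro ε hε
  obtain ⟨l, hl0, hlε⟩ := ENNReal.lt_iff_exists_nnreal_btwn.1 hε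
  have hl : 0 < l := by exact_mod_cast hl0
  -- The sets `{|u n| > l}` lie, up to null sets, in the finite-measure set `{|x| > l}`, so a.e.
  -- convergence forces their measures to zero.
  have h := tendsto_measure_of_ae_tendsto_indicator (μ := leb α) atTop (A := ∅)
    (As := fun n => {s | (l : ℝ) < |u n s|} ∩ {s | (l : ℝ) < |x s|}) MeasurableSet.empty
    (fun n => (hm _ l).inter (hm _ l)) (hm x l) (hx l hl)
    (Eventually.of_forall fun n => Set.inter_subset_right) (by
      filter_upwards [hu] with s hs
      have h1 : Tendsto (fun n => |u n s|) atTop (𝓝 0) := by simpa using hs.abs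
      filter_upwards [h1.eventually (gt_mem_nhds (show (0 : ℝ) < l from hl))] with n hn
      simp only [Set.mem_inter_iff, Set.mem_ofPred_eq, Set.mem_empty_iff_false, iff_false, not_and]
      exact fun h2 => absurd hn h2.not_gt)
  rw [measure_empty] at h
  filter_upwards [ENNReal.tendsto_nhds_zero.1 h _ (ENNReal.ofReal_pos.2 ht)] with n hn
  refine (rearr_le_of_distr_le (l := l) (le_trans ?_ hn)).trans hlε.le
  refine measure_mono_ae ?_
  filter_upwards [hux n] with s hs h1
  exact ⟨h1, lt_of_lt_of_le h1 hs⟩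

/-! ### Consequences of K-order continuity. -/

namespace BanachFunctionSpace

variable {E : BanachFunctionSpace α}

theorem rho_chi (hE : E.IsSymmetric) (t : ℝ) :
    E.rho (chi α t) = ENNReal.ofReal (E.fundamental hE t) := E.rho_of_mem (E.chi_mem hE t)

theorem rho_chi_ne_top (hE : E.IsSymmetric) (t : ℝ) : E.rho (chi α t) ≠ ∞ := by
  rw [rho_chi hE]
  exact ENNReal.ofReal_ne_top

theorem rho_chi_mono {s t : ℝ} (h : s ≤ t) : E.rho (chi α s) ≤ E.rho (chi α t) := by
  refine E.rho_mono ?_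
  filter_upwards [coeFn_ind α (Set.Ioo 0 s) measurableSet_Ioo,
    coeFn_ind α (Set.Ioo 0 t) measurableSet_Ioo] with r h1 h2
  rw [chi, h1, chi, h2]
  by_cases hr : r ∈ Set.Ioo 0 s
  · rw [Set.indicator_of_mem hr, Set.indicator_of_mem (Set.Ioo_subset_Ioo_right h hr)]
  · rw [Set.indicator_of_notMem hr, abs_zero]
    exact abs_nonneg _

theorem rho_chi_ne_zero (hE : E.IsSymmetric) (hα : α ≠ 0) {t : ℝ} (ht : 0 < t) :
    E.rho (chi α t) ≠ 0 := by
  intro h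
  rw [rho_chi hE, ENNReal.ofReal_eq_zero] at h
  have h0 : chi α t = 0 := by
    have := E.eq_zero_of_norm _ (le_antisymm h (apply_nonneg _ _))
    exact congrArg Subtype.val this
  have h1 : leb α (Set.Ioo 0 t) = 0 := by
    have h2 := distr_ind α (Set.Ioo 0 t) measurableSet_Ioo 0
    rw [if_pos one_pos] at h2
    rw [← h2]
    change distr (chi α t) 0 = 0
    rw [h0, distr, measure_eq_zero_iff_ae_notMem]
    filter_upwards [AEEqFun.coeFn_zero (μ := leb α) (β := ℝ)] with s hs
    simp [hs]
  obtain ⟨r, hr0, hr⟩ := ENNReal.lt_iff_exists_nnreal_btwn.1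
    (lt_min (pos_iff_ne_zero.2 hα) (ENNReal.ofReal_pos.2 ht))
  have hrα : ENNReal.ofReal r ≤ α := by
    rw [ENNReal.ofReal_coe_nnreal]
    exact hr.le.trans (min_le_left _ _)
  have hrt : (r : ℝ) ≤ t := by
    have := hr.le.trans (min_le_right _ _)
    rwa [← ENNReal.ofReal_coe_nnreal, ENNReal.ofReal_le_ofReal_iff ht.le] at this
  have h2 := (leb_Ioo α hrα).symm.trans_le (measure_mono (Set.Ioo_subset_Ioo_right hrt))
  rw [h1, ENNReal.ofReal_coe_nnreal] at h2
  exact absurd h2 (not_le.2 hr0)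

/-- A sequence dominated by `|x|` is submajorized by `x`, and finite distribution at positive levels
turns `u_n → 0` a.e. into `u_n* → 0`. -/
theorem IsKOCPoint.isOCPoint {x : E.carrier} (hK : E.IsKOCPoint x)
    (hx : ∀ l : ℝ≥0, 0 < l → distr (x : L0 α) l ≠ ∞) : E.IsOCPoint x := by
  intro u hu0 hux hu
  have hle : ∀ n, ∀ᵐ t ∂(leb α), |(u n : L0 α) t| ≤ |(x : L0 α) t| := fun n => by
    filter_upwards [AEEqFun.coeFn_le.2 (hu0 n), AEEqFun.coeFn_le.2 (hux n),
      AEEqFun.coeFn_abs (x : L0 α), AEEqFun.coeFn_zero (μ := leb α) (β := ℝ)] with t h1 h2 h3 h4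
    rw [h4] at h1
    rw [h3] at h2
    rwa [abs_of_nonneg h1]
  refine hK u (fun n t ht => ?_) ?_
  · rw [maxFun, maxFun]
    gcongr with s
    exact rearr_le_rearr (distr_mono (hle n)) s
  · filter_upwards [ae_leb_pos α] with t ht
    exact tendsto_rearr_of_ae hx hle hu ht.1

/-- If `x** = ∞` at one point, then everywhere, so every function is `≺ x`. The normalized
`χ_(0,1/(n+1))` have norm one while their rearrangements vanish eventually at each `t > 0`, a
contradiction. -/
theorem IsKOCPoint.maxFun_ne_top (hE : E.IsSymmetric) (hα : α ≠ 0) {x : E.carrier}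
    (hK : E.IsKOCPoint x) {t : ℝ} (ht : 0 < t) :
    maxFun (x : L0 α) t ≠ ∞ := by
  intro htop
  have hall : ∀ s : ℝ, 0 < s → maxFun (x : L0 α) s = ∞ := fun s hs => by
    by_contra h
    exact SymmSpace.maxFun_ne_top hs ht h htop
  set c : ℕ → ℝ := fun n => (E.rho (chi α (1 / ((n : ℝ) + 1)))).toReal⁻¹ with hc
  have h := hK (fun n => ⟨c n • chi α (1 / ((n : ℝ) + 1)),
    E.carrier.smul_mem _ (E.chi_mem hE _)⟩) (fun n s hs => by rw [hall s hs]; exact le_top) (by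
      filter_upwards [ae_leb_pos α] with s hs
      refine tendsto_const_nhds.congr' ?_
      obtain ⟨N, hN⟩ := exists_nat_one_div_lt hs.1
      filter_upwards [eventually_ge_atTop N] with n hn
      refine (rearr_smul_chi_of_le _ (le_trans ?_ hN.le)).symm
      gcongr)
  rw [tendsto_norm_iff] at h
  refine absurd (tendsto_nhds_unique (tendsto_const_nhds.congr fun n => ?_) h)
    (one_ne_zero (α := ℝ≥0∞))
  have hne := rho_chi_ne_zero hE hα (t := 1 / ((n : ℝ) + 1)) (by positivity)
  have hnt := rho_chi_ne_top hE (1 / ((n : ℝ) + 1))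
  have hpos := ENNReal.toReal_pos hne hnt
  rw [E.rho_smul, hc, abs_of_nonneg (by positivity), ENNReal.ofReal_inv_of_pos hpos,
    ENNReal.ofReal_toReal hnt, ENNReal.inv_mul_cancel hne hnt]

/-- Test functions `x**(s) χ_(0,s)`: for `t ≤ s` they are `≺ x` at `t` since `x**` decreases, and
for `t ≥ s` since their whole integral is at most `∫₀ˢ x*`. Their rearrangements are at most `x**(s)
→ 0`. -/
theorem IsKOCPoint.tendsto_fundamental_mul {x : E.carrier} (hE : E.IsSymmetric)
    (hK : E.IsKOCPoint x) (h1 : maxFun (x : L0 α) 1 ≠ ∞)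
    (h0 : Tendsto (rearr (x : L0 α)) atTop (𝓝 0)) :
    Tendsto (fun s : ℝ => ENNReal.ofReal (E.fundamental hE s) * maxFun (x : L0 α) s)
      atTop (𝓝 0) := by
  refine tendsto_of_seq_tendsto fun s hs => ?_
  -- Early terms of `s` may be nonpositive; the maximum changes only finitely many terms.
  set r : ℕ → ℝ := fun n => max (s n) 1 with hr
  have hr1 : ∀ n, 1 ≤ r n := fun n => le_max_right _ _
  have hr0 : ∀ n, 0 < r n := fun n => one_pos.trans_le (hr1 n)
  have hrlim : Tendsto r atTop atTop := tendsto_atTop_mono (fun n => le_max_left _ _) hs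
  have hfin : ∀ n, maxFun (x : L0 α) (r n) ≠ ∞ := fun n =>
    ne_top_of_le_ne_top h1 (maxFun_antitoneOn _ (Set.mem_Ioi.2 one_pos) (hr0 n) (hr1 n))
  set c : ℕ → ℝ≥0 := fun n => (maxFun (x : L0 α) (r n)).toNNReal with hc
  have hcc : ∀ n, (c n : ℝ≥0∞) = maxFun (x : L0 α) (r n) := fun n => ENNReal.coe_toNNReal (hfin n)
  have h := hK (fun n => ⟨(c n : ℝ) • chi α (r n), E.carrier.smul_mem _ (E.chi_mem hE _)⟩)
    (fun n t ht => by
      rw [maxFun_le_iff _ ht, ofReal_mul_maxFun _ ht]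
      rcases le_total t (r n) with htr | htr
      · refine (setLIntegral_Ioo_le fun s _ => rearr_smul_chi_le (c n) (r n) s).trans ?_
        rw [hcc, ← ofReal_mul_maxFun _ ht, mul_comm]
        gcongr
        exact maxFun_antitoneOn _ ht (hr0 n) htr
      · rw [lintegral_Ioo_split _ (hr0 n) htr, lintegral_Ioo_split _ (hr0 n) htr]
        refine add_le_add ?_ ?_
        · refine (setLIntegral_Ioo_le fun s _ => rearr_smul_chi_le (c n) (r n) s).trans ?_
          rw [hcc, mul_comm, ofReal_mul_maxFun _ (hr0 n)]
        · refine setLIntegral_mono' measurableSet_Ico fun s hs => ?_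
          rw [rearr_smul_chi_of_le _ hs.1]
          exact bot_le)
    (by
      filter_upwards with t
      refine tendsto_of_tendsto_of_tendsto_of_le_of_le tendsto_const_nhds
        ((tendsto_maxFun h1 h0).comp hrlim) (fun n => bot_le) fun n => ?_
      exact (rearr_smul_chi_le (c n) (r n) t).trans_eq (hcc n))
  rw [tendsto_norm_iff] at h
  refine h.congr' ?_
  filter_upwards [hs.eventually_ge_atTop 1] with n hn
  have hrs : r n = s n := max_eq_left hn
  rw [E.rho_smul, rho_chi hE, NNReal.abs_eq, ENNReal.ofReal_coe_nnreal, hcc, hrs, mul_comm]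
  rfl

end BanachFunctionSpace

end SymmSpace

/-! ### Order continuity and control of `φ x**` imply K-order continuity. -/

namespace SymmSpace

variable {α : ℝ≥0∞}

theorem coeFn_hi (M : ℝ≥0) (x : L0 α) :
    hi M x =ᵐ[leb α] {t | (M : ℝ) < |x t|}.indicator fun t => |x t| := coeFn_cls _ _

theorem coeFn_lo (m : ℝ≥0) (x : L0 α) :
    lo m x =ᵐ[leb α] {t | |x t| ≤ (m : ℝ)}.indicator fun t => |x t| := coeFn_cls _ _

namespace BanachFunctionSpace

variable {E : BanachFunctionSpace α}

theorem IsOCPoint.tendsto_rho {x : E.carrier} (hO : E.IsOCPoint x) {u : ℕ → L0 α}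
    (hu0 : ∀ n, ∀ᵐ t ∂(leb α), 0 ≤ u n t) (hux : ∀ n, ∀ᵐ t ∂(leb α), u n t ≤ |(x : L0 α) t|)
    (hu : ∀ᵐ t ∂(leb α), Tendsto (fun n => u n t) atTop (𝓝 0)) :
    Tendsto (fun n => E.rho (u n)) atTop (𝓝 0) := by
  have hmem : ∀ n, u n ∈ E.carrier := fun n => by
    refine E.mem_of_rho_ne_top (ne_top_of_le_ne_top (E.rho_coe_ne_top x) (E.rho_mono ?_))
    filter_upwards [hu0 n, hux n] with t h1 h2
    rwa [abs_of_nonneg h1]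
  refine (E.tendsto_norm_iff fun n => ⟨u n, hmem n⟩).1
    (hO (fun n => ⟨u n, hmem n⟩) (fun n => ?_) (fun n => ?_) hu)
  · change (0 : L0 α) ≤ u n
    rw [← AEEqFun.coeFn_le]
    filter_upwards [hu0 n, AEEqFun.coeFn_zero (μ := leb α) (β := ℝ)] with t h1 h2
    rw [h2]
    exact h1
  · change u n ≤ |(x : L0 α)|
    rw [← AEEqFun.coeFn_le]
    filter_upwards [hux n, AEEqFun.coeFn_abs (x : L0 α)] with t h1 h2
    rw [h2]
    exact h1

theorem IsOCPoint.tendsto_rho_hi {x : E.carrier} (hO : E.IsOCPoint x) :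
    Tendsto (fun n : ℕ => E.rho (hi n (x : L0 α))) atTop (𝓝 0) := by
  refine hO.tendsto_rho (fun n => ?_) (fun n => ?_) ?_
  · filter_upwards [coeFn_hi n (x : L0 α)] with t ht
    rw [ht]
    exact Set.indicator_nonneg (fun _ _ => abs_nonneg _) _
  · filter_upwards [coeFn_hi n (x : L0 α)] with t ht
    rw [ht]
    exact Set.indicator_le_self' (fun _ _ => abs_nonneg _) _
  · filter_upwards [ae_all_iff.2 fun n : ℕ => coeFn_hi n (x : L0 α)] with t ht
    refine tendsto_const_nhds.congr' ?_
    obtain ⟨N, hN⟩ := exists_nat_ge |(x : L0 α) t|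
    filter_upwards [eventually_ge_atTop N] with n hn
    rw [ht, Set.indicator_of_notMem]
    simp only [Set.mem_ofPred_eq, not_lt, NNReal.coe_natCast]
    exact hN.trans (by exact_mod_cast hn)

theorem IsOCPoint.tendsto_rho_lo {x : E.carrier} (hO : E.IsOCPoint x) :
    Tendsto (fun n : ℕ => E.rho (lo (1 / ((n : ℝ≥0) + 1)) (x : L0 α))) atTop (𝓝 0) := by
  refine hO.tendsto_rho (fun n => ?_) (fun n => ?_) ?_
  · filter_upwards [coeFn_lo (1 / ((n : ℝ≥0) + 1)) (x : L0 α)] with t ht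
    rw [ht]
    exact Set.indicator_nonneg (fun _ _ => abs_nonneg _) _
  · filter_upwards [coeFn_lo (1 / ((n : ℝ≥0) + 1)) (x : L0 α)] with t ht
    rw [ht]
    exact Set.indicator_le_self' (fun _ _ => abs_nonneg _) _
  · filter_upwards [ae_all_iff.2 fun n : ℕ => coeFn_lo (1 / ((n : ℝ≥0) + 1)) (x : L0 α)] with t ht
    refine squeeze_zero (fun n => ?_) (fun n => ?_) tendsto_one_div_add_atTop_nhds_zero_nat
    · rw [ht]
      exact Set.indicator_nonneg (fun _ _ => abs_nonneg _) _
    · rw [ht]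
      refine Set.indicator_apply_le' (fun h => ?_) fun _ => by positivity
      simpa using h

/-- If a nonzero point of order continuity exists, the fundamental function vanishes at zero. -/
theorem IsOCPoint.exists_rho_chi_le (hE : E.IsSymmetric) {x : E.carrier} (hO : E.IsOCPoint x)
    (hx : distr (x : L0 α) 0 ≠ 0) {ε : ℝ≥0∞} (hε : 0 < ε) :
    ∃ δ : ℝ, 0 < δ ∧ E.rho (chi α δ) ≤ ε := by
  have hxm : Measurable ((x : L0 α) : ℝ → ℝ) := (AEEqFun.stronglyMeasurable _).measurable
  obtain ⟨k, hk⟩ : ∃ k : ℕ, leb α {s | 1 / ((k : ℝ) + 1) < |(x : L0 α) s|} ≠ 0 := by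
    by_contra! hcon
    refine hx (measure_mono_null ?_ (measure_iUnion_null hcon))
    intro s (hs : ((0 : ℝ≥0) : ℝ) < _)
    obtain ⟨k, hk⟩ := exists_nat_one_div_lt (show (0 : ℝ) < |(x : L0 α) s| from hs)
    exact Set.mem_iUnion.2 ⟨k, hk⟩
  set c : ℝ := 1 / ((k : ℝ) + 1) with hc
  have hc0 : 0 < c := by positivity
  set A : Set ℝ := {s | c < |(x : L0 α) s|} with hA
  have hAm : MeasurableSet A := measurableSet_lt measurable_const hxm.abs
  -- Around `p` the set `A` has positive measure at every scale, so the functions `c χ_(B n)` are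
  -- nonzero, lie below `|x|` and vanish eventually off `p`. By symmetry their norms are `c φ(δ)`
  -- with `δ` the measure of `B n`.
  obtain ⟨p, -, hpA⟩ := exists_mem_forall_mem_nhdsWithin_pos_measure hk
  set B : ℕ → Set ℝ := fun n => A ∩ Metric.ball p (1 / ((n : ℝ) + 1)) with hB
  have hBm : ∀ n, MeasurableSet (B n) := fun n => hAm.inter measurableSet_ball
  have hB0 : ∀ n, 0 < leb α (B n) := fun n =>
    hpA _ (inter_mem_nhdsWithin A (Metric.ball_mem_nhds p (by positivity)))
  have hBtop : ∀ n, leb α (B n) ≠ ∞ := fun n => by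
    refine ne_top_of_le_ne_top ?_
      ((measure_mono Set.inter_subset_right).trans (Measure.restrict_apply_le _ _))
    exact measure_ball_lt_top.ne
  have hcoe : ∀ n, (c • ind α (B n) (hBm n) : L0 α) =ᵐ[leb α] (B n).indicator fun _ => c := by
    intro n
    filter_upwards [AEEqFun.coeFn_smul c (ind α (B n) (hBm n)), coeFn_ind α (B n) (hBm n)]
      with s h1 h2
    rw [h1, Pi.smul_apply, h2]
    by_cases hs : s ∈ B n <;> simp [hs]
  have hlim : Tendsto (fun n => E.rho (c • ind α (B n) (hBm n))) atTop (𝓝 0) := by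
    refine hO.tendsto_rho (fun n => ?_) (fun n => ?_) ?_
    · filter_upwards [hcoe n] with s hs
      rw [hs]
      exact Set.indicator_nonneg (fun _ _ => hc0.le) _
    · filter_upwards [hcoe n] with s hs
      rw [hs]
      exact Set.indicator_apply_le' (fun h => le_of_lt h.1) fun _ => abs_nonneg _
    · have hp : ∀ᵐ s ∂(leb α), s ≠ p := by
        refine ae_restrict_of_ae ?_
        simp [ae_iff]
      filter_upwards [ae_all_iff.2 hcoe, hp] with s hs hsp
      refine tendsto_const_nhds.congr' ?_
      obtain ⟨N, hN⟩ := exists_nat_one_div_lt (dist_pos.2 hsp)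
      filter_upwards [eventually_ge_atTop N] with n hn
      rw [hs, Set.indicator_of_notMem]
      rintro ⟨-, h⟩
      have h1 : 1 / ((n : ℝ) + 1) ≤ 1 / ((N : ℝ) + 1) := by gcongr
      exact absurd (Metric.mem_ball.1 h) (not_lt.2 (h1.trans hN.le))
  have hcε : 0 < ENNReal.ofReal c * ε := ENNReal.mul_pos (ENNReal.ofReal_pos.2 hc0).ne' hε.ne'
  obtain ⟨n, hn⟩ := (ENNReal.tendsto_nhds_zero.1 hlim _ hcε).exists
  rw [E.rho_smul, abs_of_pos hc0, ENNReal.mul_le_mul_iff_right (ENNReal.ofReal_pos.2 hc0).ne'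
    ENNReal.ofReal_ne_top] at hn
  refine ⟨(leb α (B n)).toReal, ENNReal.toReal_pos (hB0 n).ne' (hBtop n), ?_⟩
  refine le_of_eq_of_le (hE.rho_eq (equimeasurable_ind α measurableSet_Ioo (hBm n) ?_)) hn
  rw [leb_Ioo, ENNReal.ofReal_toReal (hBtop n)]
  rw [ENNReal.ofReal_toReal (hBtop n)]
  exact (measure_mono (Set.subset_univ _)).trans (leb_univ α).le

theorem measurable_toReal_rearr (x : L0 α) : Measurable fun t => (rearr x t).toReal :=
  (measurable_rearr x).ennreal_toReal

/-- The rearrangement of a point of order continuity has a small norm near zero. -/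
theorem IsOCPoint.exists_head_le (hE : E.IsSymmetric) {x : E.carrier} (hO : E.IsOCPoint x)
    (hx : ∀ l : ℝ≥0, 0 < l → distr (x : L0 α) l ≠ ∞) {ε : ℝ≥0∞} (hε : 0 < ε) :
    ∃ δ : ℝ, 0 < δ ∧ E.rho (cls α ((Set.Ioo 0 δ).indicator fun t => (rearr (x : L0 α) t).toReal)
      ((measurable_toReal_rearr _).indicator measurableSet_Ioo)) ≤ ε := by
  have hstar : Equimeasurable (star (x : L0 α)) x := equimeasurable_star (hx 1 one_pos)
  -- For `x = 0` the fundamental function need not vanish at zero, but the head is zero.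
  by_cases h0 : distr (x : L0 α) 0 = 0
  · refine ⟨1, one_pos, le_trans (E.rho_mono (y := 0) ?_) (E.rho_zero.trans_le bot_le)⟩
    filter_upwards [coeFn_cls α ((measurable_toReal_rearr (x : L0 α)).indicator
      (measurableSet_Ioo (a := (0 : ℝ)) (b := 1)))] with t ht
    have h1 : rearr (x : L0 α) t = 0 := by
      have := rearr_le_of_distr_le (x := (x : L0 α)) (l := 0) (t := t) (h0.trans_le bot_le)
      simpa using this
    rw [ht]
    simp [Set.indicator_apply, h1]
  have hε2 : 0 < ε / 2 := ENNReal.half_pos hε.ne'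
  obtain ⟨M, hM⟩ := (ENNReal.tendsto_nhds_zero.1 hO.tendsto_rho_hi _ hε2).exists
  obtain ⟨δ, hδ0, hδ⟩ := hO.exists_rho_chi_le hE h0 (ε := ε / 2 / ((M : ℝ≥0∞) + 1))
    (ENNReal.div_pos hε2.ne' (by simp))
  refine ⟨δ, hδ0, ?_⟩
  have hM' : E.rho (hi M (star (x : L0 α))) ≤ ε / 2 :=
    (hE.rho_eq (equimeasurable_hi hstar M)).trans_le hM
  have hδ' : E.rho ((M : ℝ) • chi α δ) ≤ ε / 2 := by
    rw [E.rho_smul, Nat.abs_cast, ENNReal.ofReal_natCast]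
    calc (M : ℝ≥0∞) * E.rho (chi α δ) ≤ ((M : ℝ≥0∞) + 1) * (ε / 2 / ((M : ℝ≥0∞) + 1)) := by
          gcongr
          exact le_self_add
      _ ≤ ε / 2 := ENNReal.mul_div_le
  -- The head lies below the part of `x*` above `M` plus `M χ_(0,δ)`.
  refine le_trans (E.rho_mono ?_) ((E.rho_add_le (hi M (star (x : L0 α))) ((M : ℝ) • chi α δ)).trans
    ((add_le_add hM' hδ').trans_eq (ENNReal.add_halves ε)))
  filter_upwards [coeFn_cls α ((measurable_toReal_rearr (x : L0 α)).indicator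
      (measurableSet_Ioo (a := (0 : ℝ)) (b := δ))), coeFn_hi M (star (x : L0 α)),
    coeFn_star (x : L0 α), coeFn_smul_chi (α := α) (M : ℝ) δ,
    AEEqFun.coeFn_add (hi M (star (x : L0 α))) ((M : ℝ) • chi α δ)] with t h1 h2 h3 h4 h5
  rw [h1, h5, Pi.add_apply, h2, h4]
  simp only [Set.indicator_apply, Set.mem_ofPred_eq, h3, NNReal.coe_natCast,
    abs_of_nonneg (ENNReal.toReal_nonneg (a := rearr (x : L0 α) t))]
  have hr := ENNReal.toReal_nonneg (a := rearr (x : L0 α) t)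
  have hM0 : (0 : ℝ) ≤ M := Nat.cast_nonneg M
  split_ifs with h6 h7 h7
  · rw [abs_of_nonneg hr, abs_of_nonneg (by positivity)]
    linarith
  · rw [abs_of_nonneg hr, zero_add, abs_of_nonneg hM0]
    exact not_lt.1 h7
  · simp
  · simp

/-- The rearrangement of a point of order continuity has a small norm near infinity. -/
theorem IsOCPoint.eventually_tail_le (hE : E.IsSymmetric) {x : E.carrier} (hO : E.IsOCPoint x)
    (hx : ∀ l : ℝ≥0, 0 < l → distr (x : L0 α) l ≠ ∞) {ε : ℝ≥0∞} (hε : 0 < ε) :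
    ∀ᶠ N : ℝ in atTop, E.rho (cls α ((Set.Ici N).indicator fun t => (rearr (x : L0 α) t).toReal)
      ((measurable_toReal_rearr _).indicator measurableSet_Ici)) ≤ ε := by
  have hstar : Equimeasurable (star (x : L0 α)) x := equimeasurable_star (hx 1 one_pos)
  obtain ⟨n, hn⟩ := (ENNReal.tendsto_nhds_zero.1 hO.tendsto_rho_lo _ hε).exists
  set m : ℝ≥0 := 1 / ((n : ℝ≥0) + 1) with hm
  have hm0 : 0 < m := by positivity
  -- Beyond `d_x(m)` one has `x* ≤ m`, so the tail sits inside the low part of `x*`.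
  filter_upwards [eventually_ge_atTop (distr (x : L0 α) m).toReal] with N hN
  have hlo : E.rho (lo m (star (x : L0 α))) ≤ ε := by
    refine le_of_eq_of_le (hE.rho_eq (equimeasurable_lo hstar ?_)) hn
    rw [hstar m]
    exact hx m hm0
  refine le_trans (E.rho_mono ?_) hlo
  filter_upwards [coeFn_cls α ((measurable_toReal_rearr (x : L0 α)).indicator
      (measurableSet_Ici (a := N))), coeFn_lo m (star (x : L0 α)), coeFn_star (x : L0 α)]
    with t h1 h2 h3
  rw [h1, h2]
  by_cases ht : N ≤ t
  · have h4 : rearr (x : L0 α) t ≤ m := rearr_le_of_distr_le (by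
      rw [← ENNReal.ofReal_toReal (hx m hm0)]
      exact ENNReal.ofReal_le_ofReal (hN.trans ht))
    have h5 : (rearr (x : L0 α) t).toReal ≤ m := by
      have := ENNReal.toReal_mono ENNReal.coe_ne_top h4
      simpa using this
    have h6 : t ∈ {s | |star (x : L0 α) s| ≤ (m : ℝ)} := by
      change |star (x : L0 α) t| ≤ (m : ℝ)
      rwa [h3, abs_of_nonneg ENNReal.toReal_nonneg]
    rw [Set.indicator_of_mem (show t ∈ Set.Ici N from ht), Set.indicator_of_mem h6, h3, abs_abs]
  · rw [Set.indicator_of_notMem (show t ∉ Set.Ici N from ht), abs_zero]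
    exact abs_nonneg _

/-- A function whose rearrangement is at most `e` beyond `δ` and which is dominated by `x` in the
Hardy-Littlewood-Pólya relation has its norm controlled by the head and the tail of `x*`. -/
theorem rho_le_of_HLP (hE : E.IsSymmetric) (hF : E.Fatou) (hα : α = 1 ∨ α = ∞) {x u : L0 α}
    (hx : ∀ l : ℝ≥0, 0 < l → distr x l ≠ ∞) (hu : HLP u x) {δ N : ℝ} (hδ : 0 < δ) (hN : 0 < N)
    {e c : ℝ≥0} (hue : ∀ s, δ ≤ s → rearr u s ≤ e) (hu_fin : distr u e ≠ ∞)
    (hNc : α ≤ ENNReal.ofReal N ∨ maxFun x N ≤ c) :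
    E.rho u ≤ E.rho (cls α ((Set.Ioo 0 δ).indicator fun t => (rearr x t).toReal)
        ((measurable_toReal_rearr _).indicator measurableSet_Ioo)) +
      (((c + e : ℝ≥0) : ℝ≥0∞) * E.rho (chi α N) +
      E.rho (cls α ((Set.Ici N).indicator fun t => (rearr x t).toReal)
        ((measurable_toReal_rearr _).indicator measurableSet_Ici))) := by
  set X : ℝ → ℝ := fun t => (rearr x t).toReal with hX
  have hX0 : ∀ t, 0 ≤ X t := fun t => ENNReal.toReal_nonneg
  have hXm : Measurable X := measurable_toReal_rearr x
  have hanti : ∀ {y : L0 α} {l : ℝ≥0}, distr y l ≠ ∞ →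
      AntitoneOn (fun t => (rearr y t).toReal) (Set.Ioi 0) := fun hl s hs t _ hst =>
    ENNReal.toReal_mono (rearr_ne_top hl hs) (rearr_antitone _ hst)
  have hofX : ∀ t, 0 < t → ENNReal.ofReal (X t) = rearr x t := fun t ht =>
    ENNReal.ofReal_toReal (rearr_ne_top (hx 1 one_pos) ht)
  have hXc : ∀ t, N ≤ t → X t ≤ (c + e : ℝ≥0) := by
    intro t ht
    have h1 : rearr x t ≤ c := by
      rcases hNc with h | h
      · rw [rearr_eq_zero x (h.trans (ENNReal.ofReal_le_ofReal ht))]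
        exact bot_le
      · exact (rearr_antitone x ht).trans ((rearr_le_maxFun x hN).trans h)
    have h2 := ENNReal.toReal_mono ENNReal.coe_ne_top
      (h1.trans (ENNReal.coe_le_coe.2 (le_self_add (a := c) (b := e))))
    exact h2
  have hpm : Measurable fun t : ℝ => if t < N then ((c + e : ℝ≥0) : ℝ) else X t :=
    Measurable.ite measurableSet_Iio measurable_const hXm
  -- The decreasing majorant. The plateau `c + e` serves twice: `e` covers `u*` on `[δ, N)`, while
  -- `c` keeps `w` above `x*` after `N` and covers the average `x**(N)`.
  set w : ℝ → ℝ := fun t => (Set.Ioo 0 δ).indicator X t +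
    if t < N then ((c + e : ℝ≥0) : ℝ) else X t with hw
  have hwm : Measurable w := (hXm.indicator measurableSet_Ioo).add hpm
  have hp0 : ∀ t : ℝ, 0 ≤ if t < N then ((c + e : ℝ≥0) : ℝ) else X t := fun t => by
    split_ifs
    · exact (c + e).2
    · exact hX0 t
  have hi0 : ∀ t, 0 ≤ (Set.Ioo 0 δ).indicator X t := Set.indicator_nonneg fun t _ => hX0 t
  have hw0 : ∀ t, 0 ≤ w t := fun t => add_nonneg (hi0 t) (hp0 t)
  have hwa : AntitoneOn w (Set.Ioi 0) := by
    intro s (hs : 0 < s) t (ht : 0 < t) hst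
    have hXst : X t ≤ X s := hanti (hx 1 one_pos) hs ht hst
    refine add_le_add ?_ ?_
    · by_cases h : t < δ
      · rw [Set.indicator_of_mem (show t ∈ Set.Ioo 0 δ from ⟨ht, h⟩),
          Set.indicator_of_mem (show s ∈ Set.Ioo 0 δ from ⟨hs, hst.trans_lt h⟩)]
        exact hXst
      · rw [Set.indicator_of_notMem (show t ∉ Set.Ioo 0 δ from fun h' => h h'.2)]
        exact hi0 s
    · split_ifs with h1 h2 h2
      · exact le_rfl
      · exact absurd (hst.trans_lt h1) h2
      · exact hXc t (not_lt.1 h1)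
      · exact hXst
  have hwδ : ∀ s ∈ Set.Ioo 0 δ, rearr x s ≤ ENNReal.ofReal (w s) := fun s hs => by
    rw [← hofX s hs.1]
    refine ENNReal.ofReal_le_ofReal ?_
    simp only [hw, Set.indicator_of_mem hs]
    linarith [hp0 s]
  have hwN : ∀ s, s < N → ((c + e : ℝ≥0) : ℝ≥0∞) ≤ ENNReal.ofReal (w s) := fun s hs => by
    rw [← ENNReal.ofReal_coe_nnreal]
    refine ENNReal.ofReal_le_ofReal ?_
    simp only [hw, if_pos hs]
    linarith [hi0 s]
  have hwT : ∀ s, N ≤ s → rearr x s ≤ ENNReal.ofReal (w s) := fun s hs => by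
    rw [← hofX s (hN.trans_le hs)]
    refine ENNReal.ofReal_le_ofReal ?_
    simp only [hw, if_neg (not_lt.2 hs)]
    linarith [hi0 s]
  -- Up to `δ` use `u ≺ x`; between `δ` and `N` add `u* ≤ e`; past `N` restart from `u ≺ x` on
  -- `(0,t)` and bound `∫₀ᴺ x*` by `N c`. If `I` ends by `N`, the last case is void.
  have key : ∀ t : ℝ, 0 < t → ENNReal.ofReal t ≤ α →
      ∫⁻ s in Set.Ioo 0 t, rearr u s ≤ ∫⁻ s in Set.Ioo 0 t, ENNReal.ofReal (w s) := by
    intro t ht htα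
    by_cases htN : t ≤ N
    · rcases le_total t δ with htδ | htδ
      · exact (hu.lintegral_le ht).trans (setLIntegral_mono' measurableSet_Ioo fun s hs =>
          hwδ s ⟨hs.1, hs.2.trans_le htδ⟩)
      · rw [lintegral_Ioo_split _ hδ htδ, lintegral_Ioo_split _ hδ htδ]
        refine add_le_add ((hu.lintegral_le hδ).trans
          (setLIntegral_mono' measurableSet_Ioo hwδ)) ?_
        refine setLIntegral_mono' measurableSet_Ico fun s hs => (hue s hs.1).trans ?_
        exact (ENNReal.coe_le_coe.2 le_add_self).trans (hwN s (hs.2.trans_le htN))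
    · have hNt : N < t := not_le.1 htN
      have hmax : maxFun x N ≤ c := by
        refine hNc.resolve_left fun h => htN ?_
        exact (ENNReal.ofReal_le_ofReal_iff hN.le).1 (htα.trans h)
      refine (hu.lintegral_le ht).trans ?_
      rw [lintegral_Ioo_split _ hN hNt.le, lintegral_Ioo_split _ hN hNt.le]
      refine add_le_add ?_ (setLIntegral_mono' measurableSet_Ico fun s hs => hwT s hs.1)
      refine ((maxFun_le_iff x hN c).1 hmax).trans ?_
      have h1 : ∫⁻ _ in Set.Ioo 0 N, (c : ℝ≥0∞) ≤ ∫⁻ s in Set.Ioo 0 N, ENNReal.ofReal (w s) :=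
        setLIntegral_mono' measurableSet_Ioo fun s hs =>
          (ENNReal.coe_le_coe.2 le_self_add).trans (hwN s hs.2)
      rwa [setLIntegral_const, Real.volume_Ioo, sub_zero, mul_comm] at h1
  have hmain := rho_le_of_lintegral_le hE hF hα (measurable_toReal_rearr u) hwm
    (fun t => ENNReal.toReal_nonneg) hw0 (hanti hu_fin) hwa (fun t ht htα => by
      refine le_of_eq_of_le (setLIntegral_congr_fun measurableSet_Ioo fun s hs => ?_) (key t ht htα)
      exact ENNReal.ofReal_toReal (rearr_ne_top hu_fin hs.1))
  rw [← hE.rho_eq (equimeasurable_star hu_fin)]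
  refine hmain.trans (le_trans (E.rho_mono ?_) ((E.rho_add_le _ _).trans (add_le_add le_rfl
    ((E.rho_add_le (((c + e : ℝ≥0) : ℝ) • chi α N) _).trans (add_le_add (le_of_eq ?_) le_rfl)))))
  · filter_upwards [coeFn_cls α hwm, coeFn_cls α (hXm.indicator (measurableSet_Ioo (a := 0) (b := δ))),
      coeFn_cls α (hXm.indicator (measurableSet_Ici (a := N))),
      coeFn_smul_chi (α := α) ((c + e : ℝ≥0) : ℝ) N,
      AEEqFun.coeFn_add (cls α _ (hXm.indicator (measurableSet_Ioo (a := 0) (b := δ))))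
        (((c + e : ℝ≥0) : ℝ) • chi α N + cls α _ (hXm.indicator (measurableSet_Ici (a := N)))),
      AEEqFun.coeFn_add (((c + e : ℝ≥0) : ℝ) • chi α N)
        (cls α _ (hXm.indicator (measurableSet_Ici (a := N)))), ae_leb_pos α]
      with t h1 h2 h3 h4 h5 h6 h7
    rw [h1, h5, Pi.add_apply, h6, Pi.add_apply, h2, h3, h4]
    refine le_of_eq (congrArg _ ?_)
    simp only [hw]
    congr 1
    by_cases h : t < N
    · have h8 : t ∈ Set.Ioo 0 N := ⟨h7.1, h⟩
      have h9 : t ∉ Set.Ici N := fun h' => absurd h (not_lt.2 h')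
      simp [h, h8, h9]
    · have h8 : t ∉ Set.Ioo 0 N := fun h' => h h'.2
      have h9 : t ∈ Set.Ici N := not_lt.1 h
      simp [h, h8, h9]
  · rw [E.rho_smul, NNReal.abs_eq, ENNReal.ofReal_coe_nnreal]

/-- A point of order continuity with `φ x** → 0` at infinity is a point of `K`-order continuity. -/
theorem IsOCPoint.isKOCPoint (hE : E.IsSymmetric) (hF : E.Fatou) (hα : α = 1 ∨ α = ∞)
    {x : E.carrier} (hO : E.IsOCPoint x) (hx : ∀ l : ℝ≥0, 0 < l → distr (x : L0 α) l ≠ ∞)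
    (hφ : α = ∞ → Tendsto
      (fun s : ℝ => ENNReal.ofReal (E.fundamental hE s) * maxFun (x : L0 α) s) atTop (𝓝 0)) :
    E.IsKOCPoint x := by
  have hα0 : α ≠ 0 := by rcases hα with rfl | rfl <;> simp
  intro u hu hlim
  rw [tendsto_norm_iff, ENNReal.tendsto_nhds_zero]
  intro ε₀ hε₀
  -- One `ε` each for the head, `c φ(N)`, `e φ(N)` and the tail; finiteness of `ε` is used to
  -- exclude `x**(N) = ∞`.
  obtain ⟨ε, hε, hεtop, hεε₀⟩ : ∃ ε : ℝ≥0∞, 0 < ε ∧ ε ≠ ∞ ∧ 4 * ε ≤ ε₀ := by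
    refine ⟨min (ε₀ / 4) 1, lt_min (ENNReal.div_pos hε₀.ne' (by simp)) one_pos, by simp, ?_⟩
    exact (mul_le_mul_right (min_le_left _ _) _).trans ENNReal.mul_div_le
  obtain ⟨δ, hδ, hhead⟩ := hO.exists_head_le hE hx hε
  obtain ⟨N, c, hN, hcN, htail, hNc⟩ : ∃ (N : ℝ) (c : ℝ≥0), 0 < N ∧ c * E.rho (chi α N) ≤ ε ∧
      E.rho (cls α ((Set.Ici N).indicator fun t => (rearr (x : L0 α) t).toReal)
        ((measurable_toReal_rearr _).indicator measurableSet_Ici)) ≤ ε ∧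
      (α ≤ ENNReal.ofReal N ∨ maxFun (x : L0 α) N ≤ c) := by
    rcases hα with h | h
    · refine ⟨1, 0, one_pos, by simp, ?_, Or.inl (by simp [h])⟩
      refine le_trans (E.rho_mono (y := 0) ?_) (E.rho_zero.trans_le bot_le)
      filter_upwards [coeFn_cls α ((measurable_toReal_rearr (x : L0 α)).indicator
        (measurableSet_Ici (a := (1 : ℝ)))), ae_leb_pos α] with t ht htα
      have h1 : t ∉ Set.Ici (1 : ℝ) := by
        have := htα.2
        rw [h, ENNReal.ofReal_lt_one] at this
        simpa using this
      rw [ht, Set.indicator_of_notMem h1, abs_zero]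
      exact abs_nonneg _
    · obtain ⟨N, ⟨h1, h2⟩, hN⟩ := (((ENNReal.tendsto_nhds_zero.1 (hφ h) ε hε).and
        (hO.eventually_tail_le hE hx hε)).and (eventually_gt_atTop 0)).exists
      rw [← rho_chi hE] at h1
      have hfin : maxFun (x : L0 α) N ≠ ∞ := fun h3 => by
        rw [h3, ENNReal.mul_top (rho_chi_ne_zero hE hα0 hN)] at h1
        exact hεtop (top_le_iff.1 h1)
      refine ⟨N, (maxFun (x : L0 α) N).toNNReal, hN, ?_, h2, Or.inr ?_⟩
      · rwa [ENNReal.coe_toNNReal hfin, mul_comm]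
      · rw [ENNReal.coe_toNNReal hfin]
  -- The level `e` must be chosen after `N`, since it has to beat `φ(N)`.
  obtain ⟨e, he, heN⟩ := ENNReal.exists_nnreal_pos_mul_lt (rho_chi_ne_top hE N) hε.ne'
  -- One point of convergence left of `δ` suffices: the rearrangements decrease, so `u_n*(t) ≤ e`
  -- controls everything beyond `δ` and also makes `d_{u_n}(e)` finite.
  obtain ⟨t, ht, htδ⟩ : ∃ t : ℝ, Tendsto (fun n => rearr (u n : L0 α) t) atTop (𝓝 0) ∧ t < δ := by
    by_contra! hcon
    refine rho_chi_ne_zero hE hα0 hδ (le_antisymm ?_ bot_le)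
    refine le_trans (E.rho_mono (y := 0) ?_) E.rho_zero.le
    filter_upwards [hlim, coeFn_ind α (Set.Ioo 0 δ) measurableSet_Ioo] with s hs h1
    rw [chi, h1, Set.indicator_of_notMem (fun h => absurd h.2 (not_lt.2 (hcon s hs))), abs_zero]
    exact abs_nonneg _
  filter_upwards [ENNReal.tendsto_nhds_zero.1 ht e (by exact_mod_cast he)] with n hn
  have h1 := rho_le_of_HLP hE hF hα hx (hu n) hδ hN
    (fun s hs => (rearr_antitone _ (htδ.le.trans hs)).trans hn)
    (ne_top_of_le_ne_top ENNReal.ofReal_ne_top ((rearr_le_iff _ e t).1 hn)) hNc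
  refine h1.trans (le_trans ?_ hεε₀)
  rw [ENNReal.coe_add, add_mul]
  calc _ ≤ ε + (ε + ε + ε) :=
        add_le_add hhead (add_le_add (add_le_add hcN heN.le) htail)
    _ = 4 * ε := by ring

/-- For `s ≥ 1`, `x*(s) ≤ x**(s) ≤ φ(s) x**(s) / φ(1)`, because `φ` is increasing and `φ(1) > 0`. -/
theorem tendsto_rearr_of_fundamental (hE : E.IsSymmetric) (hα : α ≠ 0) {x : L0 α}
    (h : Tendsto (fun s : ℝ => ENNReal.ofReal (E.fundamental hE s) * maxFun x s) atTop (𝓝 0)) :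
    Tendsto (rearr x) atTop (𝓝 0) := by
  have h0 := rho_chi_ne_zero hE hα one_pos
  have hlim := ENNReal.Tendsto.const_mul h (Or.inr (ENNReal.inv_ne_top.2 h0))
  rw [mul_zero] at hlim
  refine tendsto_of_tendsto_of_tendsto_of_le_of_le' tendsto_const_nhds hlim
    (Eventually.of_forall fun _ => bot_le) ?_
  filter_upwards [eventually_ge_atTop 1] with s hs
  refine (rearr_le_maxFun x (one_pos.trans_le hs)).trans ?_
  rw [← rho_chi hE, ← mul_assoc]
  refine le_mul_of_one_le_left bot_le ?_
  rw [← ENNReal.inv_mul_cancel h0 (rho_chi_ne_top hE 1)]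
  exact mul_le_mul_right (rho_chi_mono hs) _

end BanachFunctionSpace

end SymmSpace

theorem mainTheorem1 (α : ℝ≥0∞) (hα : α = 1 ∨ α = ∞)
    (E : SymmSpace.BanachFunctionSpace α) (hE : E.IsSymmetric) (hF : E.Fatou) (x : E.carrier) :
    (E.IsOCPoint x ∧
      (α = ∞ → Tendsto
        (fun s : ℝ => ENNReal.ofReal (E.fundamental hE s) * SymmSpace.maxFun (x : SymmSpace.L0 α) s)
        atTop (𝓝 0))) ↔
    (E.IsKOCPoint x ∧
      (α = ∞ → Tendsto (SymmSpace.rearr (x : SymmSpace.L0 α)) atTop (𝓝 0))) := by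
  have hα0 : α ≠ 0 := by rcases hα with rfl | rfl <;> simp
  constructor
  · rintro ⟨hO, hφ⟩
    have hlim := fun h => SymmSpace.BanachFunctionSpace.tendsto_rearr_of_fundamental hE hα0 (hφ h)
    exact ⟨hO.isKOCPoint hE hF hα (fun l hl => SymmSpace.distr_ne_top hα hlim hl) hφ, hlim⟩
  · rintro ⟨hK, hlim⟩
    exact ⟨hK.isOCPoint fun l hl => SymmSpace.distr_ne_top hα hlim hl,
      fun h => hK.tendsto_fundamental_mul hE (hK.maxFun_ne_top hE hα0 one_pos) (hlim h)⟩
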